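/- Let $\mathbb T=\mathbb R/\mathbb Z$, let $\lambda$ be Lebesgue measure on $\mathbb T$ (of total mass $1$), and write $e_n(t)=e^{2\pi i n t}$. Let $H^2(\mathbb T)$ be the space of those $h\in L^2(\lambda)$ with $\int h\,\overline{e_n}\,d\lambda=0$ for all $n<0$, and let $P_{H^2}$ be the orthogonal projection of $L^2(\lambda)$ onto $H^2(\mathbb T)$. For a finite positive measure $\mu$ on $\mathbb T$ put $\widehat\mu(n)=\int \overline{e_n}\,d\mu$ and let $D_{n-1}(\mu)=\det[\widehat\mu(k-j)]_{0\le j,k\le n-1}$. For a measurable $f\ge 0$ with $\log f\in L^1(\lambda)$ (where $\log 0=-\infty$), let $$\Phi_f(z)=\exp\left(\frac12\int_{\mathbb T}\frac{e_1(t)+z}{e_1(t)-z}\,\log f(t)\,d\lambda(t)\right)\quad(|z|<1),\qquad \varphi_f(t)=\lim_{\rho\uparrow1}\Phi_f(\rho\, e_1(t))$$ for $\lambda$-almost every $t$; if $\log f\notin L^1(\lambda)$, let $\varphi_f=0$. **Theorem.** Let $\mu$ be a finite positive measure on $\mathbb T$ with infinite support, and let $f=d\mu/d\lambda$ be the density of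 its absolutely continuous part. Let $r\ge0$ and let $f_0,\dots,f_r,g_0,\dots,g_r\in L^2(\mu)$. Then $D_{n-1}(\mu)\ne0$ for every $n\ge1$, and all the functions $f_j\overline{\varphi_f}$ and $g_j\overline{\varphi_f}$ are in $L^2(\lambda)$. Put $F_j=P_{H^2}(f_j\overline{\varphi_f})$ and $G_j=P_{H^2}(g_j\overline{\varphi_f})$, and for $n\ge1$ let $$p_j=\begin{cases}f_j&(0\le j\le r)\\ e_j&(-n\le j\le-1)\end{cases},\qquad q_j=\begin{cases}g_j&(0\le j\le r)\\ e_j&(-n\le j\le-1)\end{cases}.$$ Then $$\lim_{n\to\infty}D_{n-1}(\mu)^{-1}\det\left[\int p_j\,\overline{q_k}\,d\mu\right]_{-n\le j,k\le r}=\det\left[\int F_j\,\overline{G_k}\,d\lambda\right]_{0\le j,k\le r}.$$ -/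

import Mathlib

open MeasureTheory Filter Topology
open scoped ComplexConjugate ENNReal

noncomputable section

namespace SzegoLimit

/-- The circle `ℝ / ℤ` of length one. The exponential `e_n(t) = exp (2 π i n t)` on it is Mathlib's
`fourier n`. -/
abbrev Circle1 : Type := AddCircle (1 : ℝ)

/-- Lebesgue measure on the circle of length one (the translation invariant probability
measure). -/
abbrev leb : Measure Circle1 := AddCircle.haarAddCircle

/-- The Fourier coefficient `∫ exp (-2 π i n t) dμ(t)` of a measure on the circle. -/
def measureCoeff (μ : Measure Circle1) (n : ℤ) : ℂ :=
  ∫ t, conj (fourier n t : ℂ) ∂μ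

/-- The determinant of the Toeplitz matrix `[μ̂(k - j)]` with `0 ≤ j, k ≤ n - 1`. It is indexed by
its size `n`, so it is the determinant usually written `D_{n-1}(μ)`. -/
def toeplitzDet (μ : Measure Circle1) (n : ℕ) : ℂ :=
  (Matrix.of fun j k : Fin n => measureCoeff μ ((k : ℤ) - (j : ℤ))).det

/-- The density, with respect to Lebesgue measure, of the absolutely continuous part of `μ`. -/
def acDensity (μ : Measure Circle1) (t : Circle1) : ℝ :=
  (μ.rnDeriv leb t).toReal

/-- For `f ≥ 0`, the condition `log f ∈ L¹`, where `log 0 = -∞`. (Since `Real.log 0 = 0` in Mathlib,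
it has to be said separately that `f` vanishes only on a null set.) -/
def LogIntegrable (f : Circle1 → ℝ) : Prop :=
  (∀ᵐ t ∂leb, 0 < f t) ∧ Integrable (fun t => Real.log (f t)) leb

open Classical in
/-- The outer function in the unit disc,
`Φ_f(z) = exp (½ ∫ (e_1(t) + z) / (e_1(t) - z) log f(t) dt)` if `log f ∈ L¹`, and `0` otherwise. -/
def outerDisc (f : Circle1 → ℝ) (z : ℂ) : ℂ :=
  if LogIntegrable f then
    Complex.exp ((1 / 2 : ℂ) *
      ∫ t, ((fourier 1 t : ℂ) + z) / ((fourier 1 t : ℂ) - z) * (Real.log (f t) : ℂ) ∂leb)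
  else 0

/-- The outer function on the circle, `φ_f(t) = lim_{ρ ↑ 1} Φ_f(ρ e_1(t))`. -/
def outerFn (f : Circle1 → ℝ) (t : Circle1) : ℂ :=
  limUnder (𝓝[<] (1 : ℝ)) fun ρ : ℝ => outerDisc f ((ρ : ℂ) * (fourier 1 t : ℂ))

/-- The Hardy space `H²`: the functions in `L²` whose Fourier coefficients of negative index
vanish. -/
def hardyTwo : Submodule ℂ (Lp ℂ 2 leb) where
  carrier := {h | ∀ n : ℤ, n < 0 → fourierCoeff (h : Circle1 → ℂ) n = 0}
  zero_mem' := by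
    intro n _
    rw [← fourierBasis_repr]
    simp
  add_mem' := by
    intro a b ha hb n hn
    have h1 := ha n hn
    have h2 := hb n hn
    rw [← fourierBasis_repr] at h1 h2 ⊢
    simp [h1, h2]
  smul_mem' := by
    intro c a ha n hn
    have h1 := ha n hn
    rw [← fourierBasis_repr] at h1 ⊢
    simp [h1]

theorem isClosed_hardyTwo : IsClosed (hardyTwo : Set (Lp ℂ 2 leb)) := by
  have h : (hardyTwo : Set (Lp ℂ 2 leb)) =
      ⋂ n : ℤ, ⋂ _ : n < 0, {h | inner ℂ (fourierBasis n) h = 0} := by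
    ext x
    simp only [Set.mem_iInter, Set.mem_ofPred_eq]
    refine forall_congr' fun n => forall_congr' fun _ => ?_
    rw [← fourierBasis_repr, HilbertBasis.repr_apply_apply]
  rw [h]
  refine isClosed_iInter fun n => isClosed_iInter fun _ => isClosed_eq ?_ continuous_const
  fun_prop

instance : CompleteSpace hardyTwo := isClosed_hardyTwo.completeSpace_coe

open Classical in
/-- `P_{H²} h`, the orthogonal projection to `H²` of a function `h ∈ L²`
(and `0` for a function `h` that is not in `L²`). -/
def projHardy (h : Circle1 → ℂ) : Lp ℂ 2 leb :=
  if hh : MemLp h 2 leb then hardyTwo.starProjection (hh.toLp h) else 0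

/-- The family `e_{-1}, …, e_{-n}, f_0, …, f_r`. -/
def extend (n : ℕ) {r : ℕ} (f : Fin (r + 1) → Circle1 → ℂ) :
    Fin n ⊕ Fin (r + 1) → Circle1 → ℂ :=
  Sum.elim (fun (i : Fin n) t => (fourier (-((i : ℤ) + 1)) t : ℂ)) f

/-- The determinant of the bordered matrix `[∫ p_j conj(q_k) dμ]`, where `p` and `q` are the
families `e_{-1}, …, e_{-n}, f_0, …, f_r` and `e_{-1}, …, e_{-n}, g_0, …, g_r`. Rows and columns are
listed in the same order, so the order does not matter. -/
def borderedDet (μ : Measure Circle1) (n : ℕ) {r : ℕ} (f g : Fin (r + 1) → Circle1 → ℂ) : ℂ :=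
  (Matrix.of fun j k : Fin n ⊕ Fin (r + 1) =>
    ∫ t, extend n f j t * conj (extend n g k t) ∂μ).det

end SzegoLimit

end

/-!
Write `λ` for Lebesgue measure, `D` for the density of `μ`, and `φ` for the boundary function of the
outer function of `D`. Block elimination turns the quotient of determinants into the determinant of
the inner products `⟪g_k, f_j - P_n f_j⟫` in `L²(μ)`, with `P_n` the orthogonal projection to the
span of `e_{-1}, …, e_{-n}` (`det_fromBlocks_gram`, `borderedDet_eq`); the Toeplitz determinants do
not vanish since a nonzero polynomial has finitely many roots. As `n → ∞`, `P_n` converges strongly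
to the projection `P` to the closed span of all `e_j`, `j < 0`, the *past*. It remains to see that
`⟪g, f - P f⟫` is the inner product of the projections of `f φ̄` and `g φ̄` to `H²`
(`inner_sub_starProjection_past`).

Let `w = e_0 - P e_0` be the innovation. The orthogonal complement of the past is the closed span of
`e_k w`, `k ≥ 0` (`past_orthogonal_le_future`), and `|w|² μ = ‖w‖² λ` since both sides have the same
Fourier coefficients (`withDensity_innovation`); so `w` vanishes almost everywhere for the singular
part, and `|w|² D = ‖w‖²`.

If `w ≠ 0`, then `w D` is in `H²` with mean value `‖w‖²`. Pairing it with the outer functions of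
`1 / (D + ε)` and letting `ε → 0` shows that `log D` is integrable and
`‖w‖² ≤ exp (∫ log D)` (`logIntegrable_of_innovation_ne_zero`). Hence, if `log D` is not integrable,
the past is all of `L²(μ)` and both sides vanish.

If `log D` is integrable, then `|φ|² = D`, `φ ∈ H²` and `∫ φ = exp (½ ∫ log D)`
(`exists_outerFn_ae_eq`, which rests on Fatou's theorem on radial limits of Poisson integrals,
`ae_tendsto_poisson_integral`). Multiplication by `φ̄` is a contraction of `L²(μ)` to `L²(λ)` that
maps the past into the complement of `H²`. So `w φ̄` has mean value `exp (½ ∫ log D)`, which is at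
least `‖w‖`, while its norm is at most `‖w‖`: it is a constant (`toLeb_innovation`). Thus `e_k w`
goes to a multiple of `e_k`, the complement of the past is mapped isometrically into `H²`, and the
two projections are intertwined (`starProjection_toLeb`).
-/

namespace SzegoLimit

/-! ### The Poisson kernel -/

lemma norm_fourier_apply (n : ℤ) (s : Circle1) : ‖(fourier n s : ℂ)‖ = 1 := by
  rw [fourier_apply, Circle.norm_coe]

lemma fourier_pow (k : ℤ) (n : ℕ) (s : Circle1) :
    (fourier k s : ℂ) ^ n = fourier (k * n) s := by
  induction n with
  | zero => rw [pow_zero, Nat.cast_zero, mul_zero, fourier_zero]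
  | succ n ih => rw [pow_succ, ih, ← fourier_add, Nat.cast_succ, mul_add_one]

lemma integrable_continuous_smul {E : Type*} [NormedAddCommGroup E] [NormedSpace ℝ E]
    {ν : Measure Circle1} {k : Circle1 → ℝ} (hk : Continuous k) {g : Circle1 → E}
    (hg : Integrable g ν) : Integrable (fun s => k s • g s) ν := by
  obtain ⟨C, hC⟩ := isCompact_univ.exists_bound_of_continuousOn hk.continuousOn
  exact hg.bdd_smul C hk.aestronglyMeasurable (Eventually.of_forall fun s => hC s (Set.mem_univ s))

lemma norm_mul_fourier_lt {z : ℂ} (hz : ‖z‖ < 1) (k : ℤ) (s : Circle1) :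
    ‖z * fourier k s‖ < 1 := by
  rwa [norm_mul, norm_fourier_apply, mul_one]

lemma one_sub_mul_fourier_ne_zero {z : ℂ} (hz : ‖z‖ < 1) (k : ℤ) (s : Circle1) :
    1 - z * fourier k s ≠ 0 := by
  intro h
  have := norm_mul_fourier_lt hz k s
  rw [← sub_eq_zero.1 h, norm_one] at this
  exact lt_irrefl _ this

lemma continuous_inv_one_sub {z : ℂ} (hz : ‖z‖ < 1) (k : ℤ) :
    Continuous fun s : Circle1 => (1 - z * fourier k s)⁻¹ :=
  (by fun_prop : Continuous fun s : Circle1 => 1 - z * fourier k s).inv₀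
    (one_sub_mul_fourier_ne_zero hz k)

/-- Termwise integration of the geometric series `∑ zⁿ e_{-kn}` against an integrable function. -/
lemma hasSum_fourierCoeff_mul_pow {g : Circle1 → ℂ} (hg : Integrable g leb) {z : ℂ}
    (hz : ‖z‖ < 1) (k : ℤ) :
    HasSum (fun n : ℕ => fourierCoeff g (k * n) * z ^ n)
      (∫ s, (1 - z * fourier (-k) s)⁻¹ * g s ∂leb) := by
  have hF : ∀ n : ℕ, Integrable (fun s => (z * fourier (-k) s) ^ n * g s) leb := fun n =>
    hg.bdd_mul (c := 1) (by fun_prop) (Eventually.of_forall fun s => by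
      rw [norm_pow]
      exact pow_le_one₀ (norm_nonneg _) (norm_mul_fourier_lt hz _ s).le)
  have h := hasSum_integral_of_summable_integral_norm hF (by
    have : ∀ n : ℕ, ∫ s, ‖(z * fourier (-k) s) ^ n * g s‖ ∂leb = ‖z‖ ^ n * ∫ s, ‖g s‖ ∂leb := by
      intro n
      rw [← integral_const_mul]
      congr 1 with s
      rw [norm_mul, norm_pow, norm_mul, norm_fourier_apply, mul_one]
    simp_rw [this]
    exact (summable_geometric_of_lt_one (norm_nonneg _) hz).mul_right _)
  convert! h using 1
  · funext n
    rw [fourierCoeff, ← integral_mul_const]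
    congr 1 with s
    rw [mul_pow, fourier_pow, neg_mul, smul_eq_mul]
    ring
  · congr 1 with s
    rw [tsum_mul_right, tsum_geometric_of_norm_lt_one (norm_mul_fourier_lt hz _ s)]

lemma ofReal_poissonKernel {z : ℂ} (hz : ‖z‖ < 1) (s : Circle1) :
    (poissonKernel 0 z (fourier 1 s) : ℂ)
      = (1 - z * fourier (-1) s)⁻¹ + (1 - conj z * fourier 1 s)⁻¹ - 1 := by
  have h1 := one_sub_mul_fourier_ne_zero hz (-1) s
  have h2 := one_sub_mul_fourier_ne_zero (z := conj z) (by rwa [RCLike.norm_conj]) 1 s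
  have h3 : (fourier (-1) s : ℂ) * fourier 1 s = 1 := by
    rw [← fourier_add, neg_add_cancel, fourier_zero]
  have h4 : ((‖(fourier 1 s : ℂ) - z‖ ^ 2 : ℝ) : ℂ)
      = (1 - z * fourier (-1) s) * (1 - conj z * fourier 1 s) := by
    rw [Complex.ofReal_pow, ← Complex.mul_conj', map_sub, ← fourier_neg]
    linear_combination (1 - z * conj z) * h3
  rw [poissonKernel_def, sub_zero, sub_zero, norm_fourier_apply, Complex.ofReal_div, h4]
  push_cast
  rw [← Complex.mul_conj' z]
  field_simp
  linear_combination (z * conj z) * h3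

lemma continuous_poissonKernel {z : ℂ} (hz : ‖z‖ < 1) :
    Continuous fun s : Circle1 => poissonKernel 0 z (fourier 1 s) := by
  have : Continuous fun s : Circle1 => (poissonKernel 0 z (fourier 1 s) : ℂ) := by
    simp_rw [ofReal_poissonKernel hz]
    exact ((continuous_inv_one_sub hz _).add
      (continuous_inv_one_sub (by rwa [RCLike.norm_conj]) _)).sub continuous_const
  exact Complex.continuous_re.comp this

lemma poissonKernel_nonneg {z : ℂ} (hz : ‖z‖ < 1) (s : Circle1) :
    0 ≤ poissonKernel 0 z (fourier 1 s) := by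
  rw [poissonKernel_def, sub_zero, sub_zero, norm_fourier_apply]
  have : ‖z‖ ^ 2 ≤ 1 := pow_le_one₀ (norm_nonneg _) hz.le
  exact div_nonneg (by linarith) (by positivity)

/-- The Poisson integral of a function of analytic type is its power series. -/
lemma hasSum_poisson_integral {g : Circle1 → ℂ} (hg : Integrable g leb)
    (hneg : ∀ n : ℤ, n < 0 → fourierCoeff g n = 0) {z : ℂ} (hz : ‖z‖ < 1) :
    HasSum (fun n : ℕ => fourierCoeff g n * z ^ n)
      (∫ s, poissonKernel 0 z (fourier 1 s) • g s ∂leb) := by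
  have hz' : ‖conj z‖ < 1 := by rwa [RCLike.norm_conj]
  have h1 := hasSum_fourierCoeff_mul_pow hg hz 1
  have h2 := hasSum_fourierCoeff_mul_pow hg hz' (-1)
  have h3 : ∫ s, (1 - conj z * fourier (- -1) s)⁻¹ * g s ∂leb = ∫ s, g s ∂leb := by
    rw [← h2.tsum_eq, tsum_eq_single 0]
    · simp [fourierCoeff]
    · intro n hn
      rw [hneg _ (by omega), zero_mul]
  have hb : ∀ (a : ℂ), ‖a‖ < 1 → ∀ k : ℤ,
      Integrable (fun s => (1 - a * fourier k s)⁻¹ * g s) leb := by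
    intro a ha k
    obtain ⟨C, hC⟩ :=
      isCompact_univ.exists_bound_of_continuousOn (continuous_inv_one_sub ha k).continuousOn
    exact hg.bdd_mul (continuous_inv_one_sub ha k).aestronglyMeasurable
      (Eventually.of_forall fun s => hC s (Set.mem_univ s))
  have h4 : ∫ s, poissonKernel 0 z (fourier 1 s) • g s ∂leb
      = ∫ s, (1 - z * fourier (-1) s)⁻¹ * g s ∂leb := by
    have : ∀ s, poissonKernel 0 z (fourier 1 s) • g s = (1 - z * fourier (-1) s)⁻¹ * g s
        + (1 - conj z * fourier 1 s)⁻¹ * g s - g s := by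
      intro s
      rw [Complex.real_smul, ofReal_poissonKernel hz]
      ring
    simp_rw [this]
    rw [neg_neg] at h3
    have hadd : Integrable (fun s => (1 - z * fourier (-1) s)⁻¹ * g s
        + (1 - conj z * fourier 1 s)⁻¹ * g s) leb := (hb _ hz _).add (hb _ hz' _)
    rw [integral_sub hadd hg, integral_add (hb _ hz _) (hb _ hz' _), h3]
    ring
  rw [h4]
  simpa using h1

lemma integral_poissonKernel {z : ℂ} (hz : ‖z‖ < 1) :
    ∫ s : Circle1, poissonKernel 0 z (fourier 1 s) ∂leb = 1 := by
  have hc : (fun _ : Circle1 => (1 : ℂ)) = fourier 0 := by funext s; rw [fourier_zero]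
  have hcoef : ∀ n : ℤ, n ≠ 0 → fourierCoeff (fun _ : Circle1 => (1 : ℂ)) n = 0 := by
    intro n hn
    rw [hc, fourierCoeff_fourier, Pi.single_eq_of_ne hn]
  have h := hasSum_poisson_integral (g := fun _ => 1) (integrable_const _)
    (fun n hn => hcoef n hn.ne) hz
  have h' := h.tsum_eq
  rw [tsum_eq_single 0 (fun n hn => by rw [hcoef _ (by exact_mod_cast hn), zero_mul])] at h'
  have h0 : fourierCoeff (fun _ : Circle1 => (1 : ℂ)) 0 = 1 := by
    rw [hc, fourierCoeff_fourier, Pi.single_eq_same]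
  rw [Nat.cast_zero, h0, pow_zero, mul_one] at h'
  have h'' : ∫ s : Circle1, poissonKernel 0 z (fourier 1 s) • (1 : ℂ) ∂leb
      = ((∫ s : Circle1, poissonKernel 0 z (fourier 1 s) ∂leb : ℝ) : ℂ) := by
    rw [← integral_complex_ofReal]
    congr 1 with s
    rw [Complex.real_smul, mul_one]
  rw [h''] at h'
  exact_mod_cast h'.symm

/-- Jensen's inequality for the Poisson integral. -/
lemma exp_poisson_integral_le {l : Circle1 → ℝ} (hl : Integrable l leb)
    (hexp : Integrable (fun s => Real.exp (l s)) leb) {z : ℂ} (hz : ‖z‖ < 1) :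
    Real.exp (∫ s, poissonKernel 0 z (fourier 1 s) * l s ∂leb)
      ≤ ∫ s, poissonKernel 0 z (fourier 1 s) * Real.exp (l s) ∂leb := by
  set A := ∫ s, poissonKernel 0 z (fourier 1 s) * l s ∂leb with hA
  have hP := continuous_poissonKernel hz
  have iP : Integrable (fun s : Circle1 => poissonKernel 0 z (fourier 1 s)) leb := by
    simpa using integrable_continuous_smul hP (integrable_const (μ := leb) (1 : ℝ))
  have iPl : Integrable (fun s : Circle1 => poissonKernel 0 z (fourier 1 s) * l s) leb :=
    integrable_continuous_smul hP hl
  have iPe : Integrable (fun s : Circle1 => poissonKernel 0 z (fourier 1 s) * Real.exp (l s)) leb :=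
    integrable_continuous_smul hP hexp
  have h1 : ∫ s, (Real.exp A * (poissonKernel 0 z (fourier 1 s) * l s)
      + Real.exp A * (1 - A) * poissonKernel 0 z (fourier 1 s)) ∂leb = Real.exp A := by
    rw [integral_add (iPl.const_mul _) (iP.const_mul _), integral_const_mul, integral_const_mul,
      integral_poissonKernel hz, ← hA]
    ring
  rw [← h1]
  refine integral_mono ((iPl.const_mul _).add (iP.const_mul _)) iPe fun s => ?_
  -- the tangent line of `exp` at `A`
  have h2 : Real.exp A * (l s - A + 1) ≤ Real.exp (l s) := by
    calc Real.exp A * (l s - A + 1) ≤ Real.exp A * Real.exp (l s - A) := by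
          gcongr
          exact Real.add_one_le_exp _
      _ = Real.exp (l s) := by rw [← Real.exp_add]; ring_nf
  calc _ = poissonKernel 0 z (fourier 1 s) * (Real.exp A * (l s - A + 1)) := by ring
    _ ≤ _ := by
      gcongr
      exact poissonKernel_nonneg hz s

/-! ### Radial limits of Poisson integrals -/

lemma re_fourier_one_le (u : Circle1) : (fourier 1 u : ℂ).re ≤ 1 - 8 * ‖u‖ ^ 2 := by
  induction u using QuotientAddGroup.induction_on with
  | H x =>
  set y := x - round x with hy
  have hxy : (x : Circle1) = (y : Circle1) := by
    rw [hy, AddCircle.coe_sub]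
    have : ((round x : ℝ) : Circle1) = 0 := by
      rw [AddCircle.coe_eq_zero_iff]
      exact ⟨round x, by simp⟩
    rw [this, sub_zero]
  have hn : ‖(x : Circle1)‖ = |y| := UnitAddCircle.norm_eq
  have hy2 : |y| ≤ 1 / 2 := abs_sub_round x
  rw [hn]
  change (fourier 1 (x : Circle1) : ℂ).re ≤ _
  rw [hxy, fourier_coe_apply]
  have h1 : (2 * Real.pi * Complex.I * (1 : ℤ) * y / (1 : ℝ) : ℂ)
      = ((2 * (Real.pi * y) : ℝ) : ℂ) * Complex.I := by
    push_cast; ring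
  rw [h1, Complex.exp_ofReal_mul_I_re, Real.cos_two_mul', Real.cos_sq']
  have hpi := Real.pi_pos
  have h2 := Real.mul_abs_le_abs_sin (x := Real.pi * y) (by
    rw [abs_mul, abs_of_pos hpi]; nlinarith)
  rw [abs_mul, abs_of_pos hpi] at h2
  have h3 : 2 / Real.pi * (Real.pi * |y|) = 2 * |y| := by field_simp
  rw [h3] at h2
  have h4 : (2 * |y|) ^ 2 ≤ |Real.sin (Real.pi * y)| ^ 2 := by gcongr
  rw [sq_abs] at h4
  nlinarith

lemma norm_fourier_sub_mul_sq (s t : Circle1) (ρ : ℝ) :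
    ‖(fourier 1 s : ℂ) - ρ * fourier 1 t‖ ^ 2 = 1 - 2 * ρ * (fourier 1 (s - t) : ℂ).re + ρ ^ 2 := by
  have h0 : (fourier 1 (s - t) : ℂ) = fourier 1 s * conj (fourier 1 t : ℂ) := by
    rw [fourier_one, sub_eq_add_neg, AddCircle.toCircle_add, AddCircle.toCircle_neg, Circle.coe_mul,
      Circle.coe_inv_eq_conj, fourier_one, fourier_one]
  have h1 := norm_fourier_apply 1 s
  have h2 := norm_fourier_apply 1 t
  rw [h0, ← Complex.normSq_eq_norm_sq, Complex.normSq_sub, Complex.normSq_eq_norm_sq,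
    Complex.normSq_eq_norm_sq, norm_mul, h1, h2, map_mul, Complex.conj_ofReal, mul_left_comm,
    Complex.re_ofReal_mul, Complex.norm_real, Real.norm_eq_abs, mul_one, sq_abs]
  ring

lemma poissonKernel_le {ρ : ℝ} (h0 : 1 / 16 ≤ ρ) (h1 : ρ < 1) (s t : Circle1) :
    poissonKernel 0 (ρ * fourier 1 t) (fourier 1 s)
      ≤ 2 * ((1 - ρ) / ((1 - ρ) ^ 2 + dist s t ^ 2)) := by
  rw [poissonKernel_def, sub_zero, sub_zero, norm_fourier_sub_mul_sq, norm_mul, norm_fourier_apply,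
    norm_fourier_apply, Complex.norm_real, Real.norm_eq_abs, mul_one, sq_abs, dist_eq_norm]
  have h2 := re_fourier_one_le (s - t)
  have h3 : (1 - ρ) ^ 2 + ‖s - t‖ ^ 2 ≤ 1 - 2 * ρ * (fourier 1 (s - t) : ℂ).re + ρ ^ 2 := by
    nlinarith [mul_le_mul_of_nonneg_left h2 (by linarith : 0 ≤ ρ), sq_nonneg ‖s - t‖]
  have h4 : 0 < (1 - ρ) ^ 2 + ‖s - t‖ ^ 2 := by
    have : 0 < (1 - ρ) ^ 2 := by have : 0 < 1 - ρ := by linarith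
                                 positivity
    positivity
  rw [← mul_div_assoc]
  gcongr
  nlinarith

/-- Domination of the profile `h / (h² + d²)` of the Poisson kernel by indicators of balls of
radii `2ᵏ h < δ`, up to a remainder of order `h`. -/
lemma poisson_profile_le {h δ d : ℝ} (hh : 0 < h) (hδ : h < δ) {N : ℕ}
    (hN : δ ≤ 2 ^ N * h) :
    h / (h ^ 2 + d ^ 2)
      ≤ ∑ k ∈ Finset.range N, 4 / (4 ^ k * h) * (if d ≤ 2 ^ k * h then 1 else 0)
        + 4 * h / δ ^ 2 := by
  have hnonneg : ∀ k ∈ Finset.range N,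
      0 ≤ 4 / (4 ^ k * h) * (if d ≤ 2 ^ k * h then (1 : ℝ) else 0) := fun k _ => by
    split_ifs <;> positivity
  have hrem : 0 ≤ 4 * h / δ ^ 2 := by positivity
  by_cases hex : ∃ k, k < N ∧ d ≤ 2 ^ k * h
  · classical
    obtain ⟨hk1, hk2⟩ := Nat.find_spec hex
    have hmin := fun m => Nat.find_min hex (m := m)
    set k := Nat.find hex
    refine le_add_of_le_of_nonneg (le_trans ?_
      (Finset.single_le_sum hnonneg (Finset.mem_range.2 hk1))) hrem
    rw [if_pos hk2, mul_one]
    cases hk : k with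
    | zero =>
      rw [div_le_div_iff₀ (by positivity) (by positivity)]
      nlinarith [sq_nonneg d, sq_nonneg h]
    | succ m =>
      have hm := hmin m (by omega)
      push Not at hm
      have hm' := hm (by omega)
      rw [div_le_div_iff₀ (by positivity) (by positivity)]
      have h5 : (2 ^ m * h) ^ 2 ≤ d ^ 2 := by gcongr
      have h6 : (4 : ℝ) ^ m = (2 ^ m) ^ 2 := by rw [← pow_mul, mul_comm, pow_mul]; norm_num
      rw [pow_succ, h6]
      nlinarith [sq_nonneg h]
  · push Not at hex
    refine le_add_of_nonneg_of_le (Finset.sum_nonneg hnonneg) ?_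
    have hN0 : N ≠ 0 := by
      rintro rfl
      rw [pow_zero, one_mul] at hN
      linarith
    obtain ⟨m, rfl⟩ := Nat.exists_eq_succ_of_ne_zero hN0
    have h5 := hex m (Nat.lt_succ_self m)
    rw [Nat.succ_eq_add_one, pow_succ] at hN
    have h6 : δ / 2 ≤ d := by linarith
    have hδ0 : 0 < δ := hh.trans hδ
    have h7 : (δ / 2) ^ 2 ≤ d ^ 2 := by gcongr
    rw [div_le_div_iff₀ (by positivity) (by positivity)]
    nlinarith [sq_nonneg h, mul_le_mul_of_nonneg_left h7 hh.le, pow_pos hh 3]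

/-- Almost every point is a Lebesgue point. -/
lemma ae_lebesgue_point {E : Type*} [NormedAddCommGroup E] {g : Circle1 → E}
    (hg : Integrable g leb) :
    ∀ᵐ x ∂leb, ∀ ε > 0, ∃ δ > 0, ∀ r, 0 < r → r < δ →
      ∫ y in Metric.closedBall x r, ‖g y - g x‖ ∂leb ≤ ε * r := by
  have hvol : (volume : Measure Circle1) = leb := by
    rw [AddCircle.volume_eq_smul_haarAddCircle, ENNReal.ofReal_one, one_smul]
  have h := IsUnifLocDoublingMeasure.ae_tendsto_average_norm_sub (volume : Measure Circle1)
    (f := g) (by rw [hvol]; exact hg.locallyIntegrable) 1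
  rw [hvol] at h
  filter_upwards [h] with x hx ε hε
  have hx' := hx (ι := ℝ) (l := 𝓝[>] 0) (fun _ => x) id tendsto_id (by
    filter_upwards [self_mem_nhdsWithin] with r hr
    simpa using le_of_lt hr)
  have hev := hx'.eventually (gt_mem_nhds (half_pos hε))
  rw [eventually_nhdsWithin_iff, Metric.eventually_nhds_iff] at hev
  obtain ⟨δ, hδ, H⟩ := hev
  refine ⟨δ, hδ, fun r hr0 hrδ => ?_⟩
  have h1 := H (y := r) (by simpa [abs_of_pos hr0] using hrδ) hr0
  rw [setAverage_eq, id, smul_eq_mul] at h1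
  have hm : leb.real (Metric.closedBall x r) = min 1 (2 * r) := by
    rw [measureReal_def, ← hvol, AddCircle.volume_closedBall, ENNReal.toReal_ofReal (by positivity)]
  rw [hm] at h1
  have hpos : 0 < min 1 (2 * r) := by positivity
  rw [inv_mul_lt_iff₀ hpos] at h1
  calc _ ≤ min 1 (2 * r) * (ε / 2) := h1.le
    _ ≤ (2 * r) * (ε / 2) := by gcongr; exact min_le_right _ _
    _ = ε * r := by ring

/-- If the integrals of `G ≥ 0` over the balls of radius `r < δ` about `x` are at most `ε r`, then
the Poisson integral of `G` at `ρ e(x)` is `O(ε)` as `ρ ↑ 1`. -/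
lemma poisson_integral_le {G : Circle1 → ℝ} (iG : Integrable G leb) (hG0 : ∀ s, 0 ≤ G s)
    {x : Circle1} {ε δ : ℝ} (hε : 0 < ε)
    (H : ∀ r, 0 < r → r < δ → ∫ y in Metric.closedBall x r, G y ∂leb ≤ ε * r)
    {ρ : ℝ} (h2 : 1 / 16 ≤ ρ) (h3 : 1 - ρ < δ) (h4 : ρ < 1) :
    ∫ s, poissonKernel 0 (ρ * fourier 1 x) (fourier 1 s) * G s ∂leb
      ≤ 16 * ε + 2 * (4 * (1 - ρ) / δ ^ 2 * ∫ s, G s ∂leb) := by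
  set h := 1 - ρ with hh
  have hh0 : 0 < h := by linarith
  have hexN : ∃ N : ℕ, δ ≤ 2 ^ N * h := by
    obtain ⟨N, hN⟩ := pow_unbounded_of_one_lt (δ / h) one_lt_two
    exact ⟨N, ((div_lt_iff₀ hh0).1 hN).le⟩
  -- `N` is the number of radii `2ᵏ h` below `δ`
  obtain ⟨N, hN, hmin⟩ : ∃ N : ℕ, δ ≤ 2 ^ N * h ∧ ∀ k < N, 2 ^ k * h < δ := by
    classical
    exact ⟨Nat.find hexN, Nat.find_spec hexN, fun k hk => not_le.1 (Nat.find_min hexN hk)⟩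
  set F : ℕ → Circle1 → ℝ := fun k s =>
    4 / (4 ^ k * h) * (Metric.closedBall x (2 ^ k * h)).indicator G s with hF
  have hdom : ∀ s, poissonKernel 0 (ρ * fourier 1 x) (fourier 1 s) * G s
      ≤ 2 * (∑ k ∈ Finset.range N, F k s + 4 * h / δ ^ 2 * G s) := by
    intro s
    have h6 := poisson_profile_le hh0 h3 (d := dist s x) hN
    have h7 := poissonKernel_le h2 h4 s x
    have h8 := mul_le_mul_of_nonneg_right
      (h7.trans (mul_le_mul_of_nonneg_left h6 zero_le_two)) (hG0 s)
    refine h8.trans_eq ?_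
    rw [mul_assoc, add_mul, Finset.sum_mul]
    congr 2
    refine Finset.sum_congr rfl fun k _ => ?_
    by_cases hs : dist s x ≤ 2 ^ k * h
    · simp only [hF]
      rw [if_pos hs, Set.indicator_of_mem (Metric.mem_closedBall.2 hs), mul_one]
    · simp only [hF]
      rw [if_neg hs, Set.indicator_of_notMem (mt Metric.mem_closedBall.1 hs), mul_zero, zero_mul]
  have iF : ∀ k, Integrable (F k) leb :=
    fun k => (iG.indicator Metric.isClosed_closedBall.measurableSet).const_mul _
  have isum := integrable_finsetSum (Finset.range N) fun k _ => iF k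
  have hk : ∀ k ∈ Finset.range N, ∫ s, F k s ∂leb ≤ 4 * ε * (1 / 2) ^ k := by
    intro k hk
    rw [hF, integral_const_mul, integral_indicator Metric.isClosed_closedBall.measurableSet]
    have h8 := H (2 ^ k * h) (by positivity) (hmin k (Finset.mem_range.1 hk))
    have h9 : (4 : ℝ) ^ k = 2 ^ k * 2 ^ k := by rw [← mul_pow]; norm_num
    calc _ ≤ 4 / (4 ^ k * h) * (ε * (2 ^ k * h)) := by gcongr
      _ = _ := by rw [h9, one_div, inv_pow]; field_simp
  have hgeom : ∑ k ∈ Finset.range N, 4 * ε * (1 / 2 : ℝ) ^ k ≤ 8 * ε := by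
    rw [← Finset.mul_sum]
    have : ∑ k ∈ Finset.range N, (1 / 2 : ℝ) ^ k ≤ 2 :=
      (summable_geometric_two.sum_le_tsum _ fun k _ => by positivity).trans_eq tsum_geometric_two
    nlinarith
  have hz : ‖(ρ : ℂ) * fourier 1 x‖ < 1 := by
    rw [norm_mul, norm_fourier_apply, mul_one, Complex.norm_real, Real.norm_eq_abs, abs_lt]
    constructor <;> linarith
  have i2 : Integrable (fun s => ∑ k ∈ Finset.range N, F k s + 4 * h / δ ^ 2 * G s) leb :=
    isum.add (iG.const_mul _)
  calc _ ≤ ∫ s, 2 * (∑ k ∈ Finset.range N, F k s + 4 * h / δ ^ 2 * G s) ∂leb :=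
        integral_mono (integrable_continuous_smul (continuous_poissonKernel hz) iG)
          (i2.const_mul 2) hdom
    _ = 2 * ∑ k ∈ Finset.range N, (∫ s, F k s ∂leb) + 2 * (4 * h / δ ^ 2 * ∫ s, G s ∂leb) := by
        rw [integral_const_mul, integral_add isum (iG.const_mul _), integral_const_mul,
          integral_finsetSum _ fun k _ => iF k]
        ring
    _ ≤ 2 * (8 * ε) + 2 * (4 * h / δ ^ 2 * ∫ s, G s ∂leb) := by
        have := (Finset.sum_le_sum hk).trans hgeom
        linarith
    _ = _ := by ring

/-- **Fatou's theorem**: the Poisson integral of an integrable function has the function as its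
radial limit almost everywhere. -/
theorem ae_tendsto_poisson_integral {E : Type*} [NormedAddCommGroup E] [NormedSpace ℝ E]
    [CompleteSpace E] {g : Circle1 → E} (hg : Integrable g leb) :
    ∀ᵐ x ∂leb, Tendsto
      (fun ρ : ℝ => ∫ s, poissonKernel 0 (ρ * fourier 1 x) (fourier 1 s) • g s ∂leb)
      (𝓝[<] 1) (𝓝 (g x)) := by
  filter_upwards [ae_lebesgue_point hg] with x hx
  rw [Metric.tendsto_nhds]
  intro ε hε
  obtain ⟨δ, hδ, H⟩ := hx (ε / 32) (by positivity)
  have iG : Integrable (fun s => ‖g s - g x‖) leb := (hg.sub (integrable_const _)).norm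
  have hrem : ∀ᶠ ρ : ℝ in 𝓝[<] 1,
      2 * (4 * (1 - ρ) / δ ^ 2 * ∫ s, ‖g s - g x‖ ∂leb) < ε / 4 := by
    have : Tendsto (fun ρ : ℝ => 2 * (4 * (1 - ρ) / δ ^ 2 * ∫ s, ‖g s - g x‖ ∂leb)) (𝓝[<] 1)
        (𝓝 (2 * (4 * (1 - 1) / δ ^ 2 * ∫ s, ‖g s - g x‖ ∂leb))) :=
      (Continuous.tendsto (by fun_prop) 1).mono_left nhdsWithin_le_nhds
    refine this.eventually (gt_mem_nhds ?_)
    simpa using hε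
  have hnear : ∀ᶠ ρ : ℝ in 𝓝[<] 1, 1 / 16 < ρ ∧ 1 - δ < ρ :=
    nhdsWithin_le_nhds ((lt_mem_nhds (by norm_num)).and (lt_mem_nhds (by linarith)))
  filter_upwards [hrem, hnear, self_mem_nhdsWithin] with ρ h1 ⟨h2, h3⟩ h4
  have h4 : ρ < 1 := h4
  have hz : ‖(ρ : ℂ) * fourier 1 x‖ < 1 := by
    rw [norm_mul, norm_fourier_apply, mul_one, Complex.norm_real, Real.norm_eq_abs, abs_lt]
    constructor <;> linarith
  have cP := continuous_poissonKernel hz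
  have h5 : (∫ s, poissonKernel 0 (ρ * fourier 1 x) (fourier 1 s) • g s ∂leb) - g x
      = ∫ s, poissonKernel 0 (ρ * fourier 1 x) (fourier 1 s) • (g s - g x) ∂leb := by
    simp_rw [smul_sub]
    rw [integral_sub (integrable_continuous_smul cP hg)
      (integrable_continuous_smul cP (integrable_const _)), integral_smul_const,
      integral_poissonKernel hz, one_smul]
  rw [dist_eq_norm, h5]
  refine (norm_integral_le_of_norm_le (integrable_continuous_smul cP iG)
    (Eventually.of_forall fun s => ?_)).trans_lt
    ((poisson_integral_le iG (fun s => norm_nonneg _) (by positivity) H h2.le (by linarith)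
      h4).trans_lt ?_)
  · rw [norm_smul, Real.norm_of_nonneg (poissonKernel_nonneg hz s), smul_eq_mul]
  · linarith

/-! ### Outer functions -/

lemma outerDisc_of_logIntegrable {v : Circle1 → ℝ} (hv : LogIntegrable v) (z : ℂ) :
    outerDisc v z = Complex.exp ((1 / 2 : ℂ) *
      ∫ t, ((fourier 1 t : ℂ) + z) / ((fourier 1 t : ℂ) - z) * (Real.log (v t) : ℂ) ∂leb) :=
  if_pos hv

lemma outerFn_of_not_logIntegrable {v : Circle1 → ℝ} (hv : ¬ LogIntegrable v) (t : Circle1) :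
    outerFn v t = 0 := by
  have : (fun ρ : ℝ => outerDisc v ((ρ : ℂ) * (fourier 1 t : ℂ))) = fun _ => 0 :=
    funext fun ρ => if_neg hv
  rw [outerFn, this]
  exact tendsto_const_nhds.limUnder_eq

lemma outerDisc_zero {v : Circle1 → ℝ} (hv : LogIntegrable v) :
    outerDisc v 0 = (Real.exp (1 / 2 * ∫ t, Real.log (v t) ∂leb) : ℂ) := by
  have h : ∀ t : Circle1, ((fourier 1 t : ℂ) + 0) / ((fourier 1 t : ℂ) - 0) = 1 := fun t => by
    rw [add_zero, sub_zero, div_self]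
    rw [← norm_ne_zero_iff, norm_fourier_apply]
    exact one_ne_zero
  simp_rw [outerDisc_of_logIntegrable hv, h, one_mul]
  rw [integral_complex_ofReal]
  push_cast
  rfl

lemma herglotz_eq {z : ℂ} (hz : ‖z‖ < 1) (t : Circle1) :
    ((fourier 1 t : ℂ) + z) / ((fourier 1 t : ℂ) - z) = 2 * (1 - z * fourier (-1) t)⁻¹ - 1 := by
  have h1 := one_sub_mul_fourier_ne_zero hz (-1) t
  have h3 : (fourier (-1) t : ℂ) * fourier 1 t = 1 := by
    rw [← fourier_add, neg_add_cancel, fourier_zero]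
  have h2 : (fourier 1 t : ℂ) - z ≠ 0 := by
    intro h
    apply h1
    rw [← sub_eq_zero.1 h, mul_comm, h3, sub_self]
  field_simp
  linear_combination (-2 * z) * h3

lemma integrable_herglotz {l : Circle1 → ℝ} (hl : Integrable l leb) {z : ℂ} (hz : ‖z‖ < 1) :
    Integrable (fun t => (1 - z * fourier (-1) t)⁻¹ * (l t : ℂ)) leb := by
  obtain ⟨C, hC⟩ :=
    isCompact_univ.exists_bound_of_continuousOn (continuous_inv_one_sub hz (-1)).continuousOn
  exact hl.ofReal.bdd_mul (continuous_inv_one_sub hz _).aestronglyMeasurable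
    (Eventually.of_forall fun s => hC s (Set.mem_univ s))

lemma outerDisc_eq_exp_tsum {v : Circle1 → ℝ} (hv : LogIntegrable v) {z : ℂ} (hz : ‖z‖ < 1) :
    outerDisc v z = Complex.exp ((1 / 2 : ℂ) *
      (2 * (∑' n : ℕ, fourierCoeff (fun t => (Real.log (v t) : ℂ)) n * z ^ n)
        - ∫ t, (Real.log (v t) : ℂ) ∂leb)) := by
  have h := (hasSum_fourierCoeff_mul_pow hv.2.ofReal hz 1).tsum_eq
  simp only [one_mul] at h
  simp_rw [outerDisc_of_logIntegrable hv, herglotz_eq hz]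
  have h2 : ∀ t : Circle1, (2 * (1 - z * fourier (-1) t)⁻¹ - 1) * (Real.log (v t) : ℂ)
      = 2 * ((1 - z * fourier (-1) t)⁻¹ * (Real.log (v t) : ℂ)) - (Real.log (v t) : ℂ) :=
    fun t => by ring
  simp_rw [h2]
  have hlc : Integrable (fun t => (Real.log (v t) : ℂ)) leb := hv.2.ofReal
  rw [integral_sub ((integrable_herglotz hv.2 hz).const_mul 2) hlc, integral_const_mul]
  congr 4
  exact h.symm

lemma norm_fourierCoeff_le (g : Circle1 → ℂ) (n : ℤ) :
    ‖fourierCoeff g n‖ ≤ ∫ t, ‖g t‖ ∂leb := by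
  refine (norm_integral_le_integral_norm _).trans_eq ?_
  congr 1 with t
  rw [norm_smul, norm_fourier_apply, one_mul]

lemma differentiableOn_tsum_pow {a : ℕ → ℂ} {C : ℝ} (ha : ∀ n, ‖a n‖ ≤ C) :
    DifferentiableOn ℂ (fun z => ∑' n : ℕ, a n * z ^ n) (Metric.ball 0 1) := by
  intro z hz
  rw [mem_ball_zero_iff] at hz
  obtain ⟨r, hzr, hr⟩ := exists_between hz
  have hr0 : 0 ≤ r := (norm_nonneg z).trans hzr.le
  have hd : DifferentiableOn ℂ (fun z => ∑' n : ℕ, a n * z ^ n) (Metric.ball 0 r) := by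
    refine Complex.differentiableOn_tsum_of_summable_norm (u := fun n => C * r ^ n)
      ((summable_geometric_of_lt_one hr0 hr).mul_left C) (fun n => by fun_prop) Metric.isOpen_ball
      fun n w hw => ?_
    rw [mem_ball_zero_iff] at hw
    rw [norm_mul, norm_pow]
    have := (norm_nonneg _).trans (ha n)
    gcongr
    exact ha n
  exact (hd.differentiableAt
    (Metric.isOpen_ball.mem_nhds (by rwa [mem_ball_zero_iff]))).differentiableWithinAt

lemma differentiableOn_outerDisc {v : Circle1 → ℝ} (hv : LogIntegrable v) :
    DifferentiableOn ℂ (outerDisc v) (Metric.ball 0 1) := by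
  have h := differentiableOn_tsum_pow fun n : ℕ =>
    norm_fourierCoeff_le (fun t => (Real.log (v t) : ℂ)) n
  refine DifferentiableOn.congr (f := fun z => Complex.exp ((1 / 2 : ℂ) *
      (2 * (∑' n : ℕ, fourierCoeff (fun t => (Real.log (v t) : ℂ)) n * z ^ n)
        - ∫ t, (Real.log (v t) : ℂ) ∂leb))) ?_ fun z hz =>
          outerDisc_eq_exp_tsum hv (by rwa [mem_ball_zero_iff] at hz)
  exact (((h.const_mul 2).sub_const _).const_mul _).cexp

lemma exists_hasSum_outerDisc {v : Circle1 → ℝ} (hv : LogIntegrable v) :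
    ∃ a : ℕ → ℂ, ∀ z, ‖z‖ < 1 → HasSum (fun n => a n * z ^ n) (outerDisc v z) := by
  refine ⟨fun n => (n.factorial : ℂ)⁻¹ * iteratedDeriv n (outerDisc v) 0, fun z hz => ?_⟩
  have h := Complex.hasSum_taylorSeries_on_ball (differentiableOn_outerDisc hv)
    (z := z) (by rwa [mem_ball_zero_iff])
  convert! h using 2 with n
  rw [sub_zero, smul_eq_mul, smul_eq_mul]
  ring

/-- `log |Φ_v|²` is the Poisson integral of `log v`. -/
lemma norm_outerDisc_sq {v : Circle1 → ℝ} (hv : LogIntegrable v) {z : ℂ} (hz : ‖z‖ < 1) :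
    ‖outerDisc v z‖ ^ 2
      = Real.exp (∫ s, poissonKernel 0 z (fourier 1 s) * Real.log (v s) ∂leb) := by
  have hi : Integrable (fun t : Circle1 =>
      ((fourier 1 t : ℂ) + z) / ((fourier 1 t : ℂ) - z) * (Real.log (v t) : ℂ)) leb := by
    have := ((integrable_herglotz hv.2 hz).const_mul 2).sub hv.2.ofReal
    refine this.congr (Eventually.of_forall fun t => ?_)
    simp only [Pi.sub_apply, herglotz_eq hz]
    change _ - ((Real.log (v t) : ℝ) : ℂ) = _
    ring
  rw [outerDisc_of_logIntegrable hv, Complex.norm_exp, ← Real.exp_nat_mul]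
  congr 1
  have h1 : (1 / 2 : ℂ) = ((1 / 2 : ℝ) : ℂ) := by push_cast; rfl
  rw [h1, Complex.re_ofReal_mul]
  have h2 := integral_re hi
  simp only [RCLike.re_to_complex] at h2
  rw [← h2, ← mul_assoc]
  norm_num
  congr 1 with t
  rw [poissonKernel_eq_re_herglotzRieszKernel, Function.comp_apply, herglotzRieszKernel_def,
    sub_zero, sub_zero]

lemma norm_outerDisc_sq_le {v : Circle1 → ℝ} (hv : LogIntegrable v) (hvi : Integrable v leb)
    {z : ℂ} (hz : ‖z‖ < 1) :
    ‖outerDisc v z‖ ^ 2 ≤ ∫ s, poissonKernel 0 z (fourier 1 s) * v s ∂leb := by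
  have hexp : (fun s => Real.exp (Real.log (v s))) =ᵐ[leb] v := by
    filter_upwards [hv.1] with s hs using Real.exp_log hs
  rw [norm_outerDisc_sq hv hz]
  refine (exp_poisson_integral_le hv.2 (hvi.congr hexp.symm) hz).trans_eq ?_
  refine integral_congr_ae ?_
  filter_upwards [hexp] with s hs
  rw [hs]

lemma norm_mul_fourier_one_lt {ρ : ℝ} (h0 : 0 ≤ ρ) (h1 : ρ < 1) (t : Circle1) :
    ‖(ρ : ℂ) * fourier 1 t‖ < 1 :=
  norm_mul_fourier_lt (by rwa [Complex.norm_real, Real.norm_of_nonneg h0]) 1 t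

lemma poissonKernel_comm (ρ : ℝ) (s t : Circle1) :
    poissonKernel 0 (ρ * fourier 1 t) (fourier 1 s)
      = poissonKernel 0 (ρ * fourier 1 s) (fourier 1 t) := by
  have h : (fourier 1 (s - t) : ℂ).re = (fourier 1 (t - s) : ℂ).re := by
    rw [← neg_sub, fourier_one, AddCircle.toCircle_neg, Circle.coe_inv_eq_conj, Complex.conj_re,
      fourier_one]
  simp only [poissonKernel_def, sub_zero, norm_fourier_sub_mul_sq, h, norm_mul, norm_fourier_apply]

lemma continuous_poissonKernel_prod {ρ : ℝ} (h0 : 0 ≤ ρ) (h1 : ρ < 1) :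
    Continuous fun p : Circle1 × Circle1 =>
      poissonKernel 0 (ρ * fourier 1 p.1) (fourier 1 p.2) := by
  simp only [poissonKernel_def, sub_zero]
  refine Continuous.div (by fun_prop) (by fun_prop) fun p => ?_
  rw [pow_ne_zero_iff two_ne_zero, norm_ne_zero_iff, sub_ne_zero]
  intro h
  have := norm_mul_fourier_one_lt h0 h1 p.1
  rw [← h, norm_fourier_apply] at this
  exact lt_irrefl _ this

lemma integral_norm_outerDisc_sq_le {v : Circle1 → ℝ} (hv : LogIntegrable v)
    (hvi : Integrable v leb) {ρ : ℝ} (h0 : 0 ≤ ρ) (h1 : ρ < 1) :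
    ∫ t, ‖outerDisc v (ρ * fourier 1 t)‖ ^ 2 ∂leb ≤ ∫ s, v s ∂leb := by
  have hi : Integrable (fun p : Circle1 × Circle1 =>
      poissonKernel 0 (ρ * fourier 1 p.1) (fourier 1 p.2) * v p.2) (leb.prod leb) := by
    obtain ⟨C, hC⟩ := isCompact_univ.exists_bound_of_continuousOn
      (continuous_poissonKernel_prod h0 h1).continuousOn
    exact (hvi.comp_snd leb).bdd_mul (continuous_poissonKernel_prod h0 h1).aestronglyMeasurable
      (Eventually.of_forall fun s => hC s (Set.mem_univ s))
  calc ∫ t, ‖outerDisc v (ρ * fourier 1 t)‖ ^ 2 ∂leb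
      ≤ ∫ t, ∫ s, poissonKernel 0 (ρ * fourier 1 t) (fourier 1 s) * v s ∂leb ∂leb :=
        integral_mono_of_nonneg (Eventually.of_forall fun t => by positivity) hi.integral_prod_left
          (Eventually.of_forall fun t =>
            norm_outerDisc_sq_le hv hvi (norm_mul_fourier_one_lt h0 h1 t))
    _ = ∫ s, ∫ t, poissonKernel 0 (ρ * fourier 1 t) (fourier 1 s) * v s ∂leb ∂leb :=
        integral_integral_swap hi
    _ = ∫ s, v s ∂leb := by
        congr 1 with s
        simp_rw [poissonKernel_comm ρ s]
        rw [integral_mul_const, integral_poissonKernel (norm_mul_fourier_one_lt h0 h1 s), one_mul]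

lemma fourierCoeff_fourier_apply (k n : ℤ) :
    fourierCoeff (fun t : Circle1 => (fourier k t : ℂ)) n = if n = k then 1 else 0 := by
  rw [show (fun t : Circle1 => (fourier k t : ℂ)) = ⇑(fourier k) from rfl, fourierCoeff_fourier,
    Pi.single_apply]

lemma fourierCoeff_of_hasSum {a : ℕ → ℂ} {ρ : ℝ} (h0 : 0 ≤ ρ)
    (hs : Summable fun n => ‖a n‖ * ρ ^ n) {F : Circle1 → ℂ}
    (hF : ∀ t, HasSum (fun n => a n * (ρ * fourier 1 t) ^ n) (F t)) (m : ℕ) :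
    fourierCoeff F m = a m * ρ ^ m := by
  have hterm : ∀ n : ℕ, ∀ t : Circle1, fourier (-(m : ℤ)) t • (a n * (ρ * fourier 1 t) ^ n)
      = (a n * ρ ^ n) * (fourier (-(m : ℤ)) t • (fourier n t : ℂ)) := by
    intro n t
    rw [mul_pow, fourier_pow, one_mul, smul_eq_mul, smul_eq_mul]
    ring
  have h := hasSum_integral_of_summable_integral_norm (μ := leb)
    (F := fun (n : ℕ) (t : Circle1) => fourier (-(m : ℤ)) t • (a n * (ρ * fourier 1 t) ^ n))
    (fun n => (Continuous.integrable_of_hasCompactSupport (by fun_prop)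
      (HasCompactSupport.of_compactSpace _))) (by
    have : ∀ n : ℕ, ∫ t : Circle1, ‖fourier (-(m : ℤ)) t • (a n * (ρ * fourier 1 t) ^ n)‖ ∂leb
        = ‖a n‖ * ρ ^ n := by
      intro n
      simp_rw [hterm, norm_mul, norm_smul, norm_fourier_apply, norm_pow, Complex.norm_real,
        Real.norm_of_nonneg h0]
      simp
    simpa only [this] using hs)
  have h2 : ∀ t, ∑' n : ℕ, fourier (-(m : ℤ)) t • (a n * (ρ * fourier 1 t) ^ n)
      = fourier (-(m : ℤ)) t • F t := fun t => by
    rw [← (hF t).tsum_eq, tsum_const_smul'']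
  have h3 : ∀ n : ℕ, ∫ t : Circle1, fourier (-(m : ℤ)) t • (a n * (ρ * fourier 1 t) ^ n) ∂leb
      = if n = m then a m * ρ ^ m else 0 := by
    intro n
    simp_rw [hterm, integral_const_mul]
    have := fourierCoeff_fourier_apply n m
    rw [fourierCoeff] at this
    rw [this]
    by_cases hnm : n = m
    · simp [hnm]
    · rw [if_neg hnm, if_neg (by omega), mul_zero]
  simp_rw [h2, h3] at h
  exact h.unique (hasSum_ite_eq m _)

/-- The Taylor coefficients of the outer function are square summable: Parseval's identity on the
circles of radius `ρ < 1`, and `ρ ↑ 1`. -/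
lemma sum_norm_sq_le {v : Circle1 → ℝ} (hv : LogIntegrable v) (hvi : Integrable v leb)
    {a : ℕ → ℂ} (ha : ∀ z, ‖z‖ < 1 → HasSum (fun n => a n * z ^ n) (outerDisc v z)) (N : ℕ) :
    ∑ n ∈ Finset.range N, ‖a n‖ ^ 2 ≤ ∫ s, v s ∂leb := by
  have key : ∀ ρ : ℝ, 0 ≤ ρ → ρ < 1 →
      ∑ n ∈ Finset.range N, ‖a n‖ ^ 2 * (ρ ^ n) ^ 2 ≤ ∫ s, v s ∂leb := by
    intro ρ h0 h1
    refine le_trans ?_ (integral_norm_outerDisc_sq_le hv hvi h0 h1)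
    set F : Circle1 → ℂ := fun t => outerDisc v (ρ * fourier 1 t) with hF
    have cF : Continuous F := by
      refine (differentiableOn_outerDisc hv).continuousOn.comp_continuous (by fun_prop) fun t => ?_
      rw [mem_ball_zero_iff]
      exact norm_mul_fourier_one_lt h0 h1 t
    have hmem : MemLp F 2 leb := cF.memLp_of_hasCompactSupport (HasCompactSupport.of_compactSpace _)
    have hcoef : ∀ m : ℕ, fourierCoeff F m = a m * ρ ^ m := by
      refine fourierCoeff_of_hasSum h0 ?_ fun t => ha _ (norm_mul_fourier_one_lt h0 h1 t)
      have := (ha ρ (by rwa [Complex.norm_real, Real.norm_of_nonneg h0])).summable.norm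
      simpa only [norm_mul, norm_pow, Complex.norm_real, Real.norm_of_nonneg h0] using this
    have hpars := hasSum_sq_fourierCoeff (hmem.toLp F)
    have h2 : ∫ t, ‖hmem.toLp F t‖ ^ 2 ∂leb = ∫ t, ‖F t‖ ^ 2 ∂leb := by
      refine integral_congr_ae ?_
      filter_upwards [hmem.coeFn_toLp] with t ht
      rw [ht]
    have h3 : ∀ m, fourierCoeff (hmem.toLp F) m = fourierCoeff F m := fun m =>
      congrFun (fourierCoeff_congr_ae hmem.coeFn_toLp) m
    rw [h2] at hpars
    simp_rw [h3] at hpars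
    have h4 := sum_le_hasSum ((Finset.range N).map Nat.castEmbedding) (fun i _ => by positivity)
      hpars
    rw [Finset.sum_map] at h4
    refine le_trans (le_of_eq ?_) h4
    refine Finset.sum_congr rfl fun n _ => ?_
    rw [Nat.castEmbedding_apply, hcoef, norm_mul, norm_pow, Complex.norm_real,
      Real.norm_of_nonneg h0, mul_pow]
  have hlim : Tendsto (fun ρ : ℝ => ∑ n ∈ Finset.range N, ‖a n‖ ^ 2 * (ρ ^ n) ^ 2) (𝓝[<] 1)
      (𝓝 (∑ n ∈ Finset.range N, ‖a n‖ ^ 2 * (1 ^ n) ^ 2)) :=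
    (Continuous.tendsto (by fun_prop) 1).mono_left nhdsWithin_le_nhds
  simp only [one_pow, mul_one] at hlim
  refine le_of_tendsto hlim ?_
  have hpos : ∀ᶠ ρ : ℝ in 𝓝[<] 1, 0 < ρ := nhdsWithin_le_nhds (lt_mem_nhds one_pos)
  filter_upwards [hpos, self_mem_nhdsWithin] with ρ h0 h1
  exact key ρ h0.le h1

/-- A square summable sequence is the sequence of Fourier coefficients of a function of `H²`. -/
lemma exists_fourierCoeff_eq {a : ℕ → ℂ} (ha : Summable fun n => ‖a n‖ ^ 2) :
    ∃ F : Lp ℂ 2 leb, (∀ n : ℕ, fourierCoeff F n = a n) ∧ ∀ n : ℤ, n < 0 → fourierCoeff F n = 0 := by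
  set b : ℤ → ℂ := fun n => if 0 ≤ n then a n.toNat else 0 with hb
  have hmem : Memℓp b 2 := by
    refine memℓp_gen ?_
    have h2 : (2 : ℝ≥0∞).toReal = ((2 : ℕ) : ℝ) := by simp
    simp_rw [h2, Real.rpow_natCast]
    refine (Function.Injective.summable_iff (f := fun n => ‖b n‖ ^ 2)
      (Nat.cast_injective (R := ℤ)) fun n hn => ?_).1 ?_
    · have : ¬ 0 ≤ n := fun h => hn ⟨n.toNat, Int.toNat_of_nonneg h⟩
      simp [hb, this]
    · simpa [hb, Function.comp_def] using ha
  refine ⟨fourierBasis.repr.symm ⟨b, hmem⟩, fun n => ?_, fun n hn => ?_⟩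
  · rw [← fourierBasis_repr, LinearIsometryEquiv.apply_symm_apply]
    simp [hb]
  · rw [← fourierBasis_repr, LinearIsometryEquiv.apply_symm_apply]
    simp [hb, hn]

lemma integrable_coe_Lp {ν : Measure Circle1} [IsFiniteMeasure ν] (F : Lp ℂ 2 ν) :
    Integrable F ν :=
  (Lp.memLp F).integrable one_le_two

/-- The boundary function of the outer function of an integrable `v` with `log v ∈ L¹`: it is in
`H²`, its mean value is `Φ_v(0)`, and its squared modulus is `v`. -/
theorem exists_outerFn_ae_eq {v : Circle1 → ℝ} (hv : LogIntegrable v) (hvi : Integrable v leb) :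
    ∃ F : Lp ℂ 2 leb, outerFn v =ᵐ[leb] F ∧ (∀ᵐ t ∂leb, ‖F t‖ ^ 2 = v t) ∧
      (∀ n : ℤ, n < 0 → fourierCoeff F n = 0) ∧
      fourierCoeff F 0 = (Real.exp (1 / 2 * ∫ t, Real.log (v t) ∂leb) : ℂ) := by
  obtain ⟨a, ha⟩ := exists_hasSum_outerDisc hv
  obtain ⟨F, hF1, hF2⟩ := exists_fourierCoeff_eq (a := a)
    (summable_of_sum_range_le (fun n => by positivity) (sum_norm_sq_le hv hvi ha))
  have hiF := integrable_coe_Lp F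
  have hpois : ∀ z, ‖z‖ < 1 →
      ∫ s, poissonKernel 0 z (fourier 1 s) • F s ∂leb = outerDisc v z := by
    intro z hz
    have h := hasSum_poisson_integral hiF hF2 hz
    simp_rw [hF1] at h
    exact h.unique (ha z hz)
  have hpos : ∀ᶠ ρ : ℝ in 𝓝[<] 1, 0 < ρ := nhdsWithin_le_nhds (lt_mem_nhds one_pos)
  have hlim : ∀ᵐ t ∂leb, Tendsto (fun ρ : ℝ => outerDisc v (ρ * fourier 1 t)) (𝓝[<] 1)
      (𝓝 (F t)) := by
    filter_upwards [ae_tendsto_poisson_integral hiF] with t ht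
    refine ht.congr' ?_
    filter_upwards [hpos, self_mem_nhdsWithin] with ρ h0 h1
    exact hpois _ (norm_mul_fourier_one_lt h0.le h1 t)
  refine ⟨F, ?_, ?_, hF2, ?_⟩
  · filter_upwards [hlim] with t ht using ht.limUnder_eq
  · filter_upwards [hlim, ae_tendsto_poisson_integral hv.2, hv.1] with t h1 h2 h3
    have h4 := (Real.continuous_exp.tendsto _).comp h2
    rw [Real.exp_log h3] at h4
    refine tendsto_nhds_unique ((h1.norm.pow 2).congr' ?_) h4
    filter_upwards [hpos, self_mem_nhdsWithin] with ρ h0 h1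
    rw [norm_outerDisc_sq hv (norm_mul_fourier_one_lt h0.le h1 t)]
    rfl
  · rw [← outerDisc_zero hv, ← hpois 0 (by simp)]
    have h := hasSum_poisson_integral hiF hF2 (z := 0) (by simp)
    rw [← h.tsum_eq, tsum_eq_single 0 (fun n hn => by rw [zero_pow hn, mul_zero]), pow_zero,
      mul_one, Nat.cast_zero]

/-! ### Multiplication operators between `L²` spaces -/

lemma lintegral_enorm_mul_sq_le {μ ν : Measure Circle1} {m h : Circle1 → ℂ}
    (hm : AEStronglyMeasurable m ν) (hle : ν.withDensity (fun t => ‖m t‖ₑ ^ 2) ≤ μ)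
    (hac : ν ≪ μ) (hh : AEStronglyMeasurable h μ) :
    ∫⁻ t, ‖h t * m t‖ₑ ^ 2 ∂ν ≤ ∫⁻ t, ‖h t‖ₑ ^ 2 ∂μ := by
  calc ∫⁻ t, ‖h t * m t‖ₑ ^ 2 ∂ν
      = ∫⁻ t, ((fun t => ‖m t‖ₑ ^ 2) * fun t => ‖h t‖ₑ ^ 2) t ∂ν := by
        congr 1 with t
        rw [enorm_mul, mul_pow, mul_comm]
        rfl
    _ = ∫⁻ t, ‖h t‖ₑ ^ 2 ∂(ν.withDensity fun t => ‖m t‖ₑ ^ 2) :=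
        (lintegral_withDensity_eq_lintegral_mul₀ (hm.enorm.pow_const 2)
          ((hh.mono_ac hac).enorm.pow_const 2)).symm
    _ ≤ _ := lintegral_mono' hle le_rfl

lemma eLpNorm_two_eq {ν : Measure Circle1} (h : Circle1 → ℂ) :
    eLpNorm h 2 ν = (∫⁻ t, ‖h t‖ₑ ^ 2 ∂ν) ^ (1 / 2 : ℝ) := by
  rw [eLpNorm_eq_lintegral_rpow_enorm_toReal two_ne_zero ENNReal.ofNat_ne_top]
  simp

lemma eLpNorm_mul_le {μ ν : Measure Circle1} {m h : Circle1 → ℂ}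
    (hm : AEStronglyMeasurable m ν) (hle : ν.withDensity (fun t => ‖m t‖ₑ ^ 2) ≤ μ)
    (hac : ν ≪ μ) (hh : AEStronglyMeasurable h μ) :
    eLpNorm (fun t => h t * m t) 2 ν ≤ eLpNorm h 2 μ := by
  rw [eLpNorm_two_eq, eLpNorm_two_eq]
  exact ENNReal.rpow_le_rpow (lintegral_enorm_mul_sq_le hm hle hac hh) (by norm_num)

lemma memLp_mul {μ ν : Measure Circle1} {m h : Circle1 → ℂ}
    (hm : AEStronglyMeasurable m ν) (hle : ν.withDensity (fun t => ‖m t‖ₑ ^ 2) ≤ μ)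
    (hac : ν ≪ μ) (hh : MemLp h 2 μ) : MemLp (fun t => h t * m t) 2 ν :=
  ⟨(hh.1.mono_ac hac).mul hm, (eLpNorm_mul_le hm hle hac hh.1).trans_lt hh.2⟩

/-- Multiplication by `m`, as a contraction of `L²(μ)` to `L²(ν)` for `|m|² ν ≤ μ`. -/
noncomputable def mulCLM {μ ν : Measure Circle1} (m : Circle1 → ℂ) (hm : AEStronglyMeasurable m ν)
    (hle : ν.withDensity (fun t => ‖m t‖ₑ ^ 2) ≤ μ) (hac : ν ≪ μ) : Lp ℂ 2 μ →L[ℂ] Lp ℂ 2 ν :=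
  LinearMap.mkContinuous
    { toFun := fun h => (memLp_mul hm hle hac (Lp.memLp h)).toLp _
      map_add' := fun x y => by
        rw [← MemLp.toLp_add, MemLp.toLp_eq_toLp_iff]
        filter_upwards [hac.ae_le (Lp.coeFn_add x y)] with t ht
        simp only [Pi.add_apply] at ht ⊢
        rw [ht, add_mul]
      map_smul' := fun c x => by
        rw [RingHom.id_apply, ← MemLp.toLp_const_smul, MemLp.toLp_eq_toLp_iff]
        filter_upwards [hac.ae_le (Lp.coeFn_smul c x)] with t ht
        simp only [Pi.smul_apply, smul_eq_mul] at ht ⊢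
        rw [ht, mul_assoc] } 1 fun h => by
    rw [one_mul]
    change ‖(memLp_mul hm hle hac (Lp.memLp h)).toLp _‖ ≤ _
    rw [Lp.norm_toLp, Lp.norm_def]
    exact ENNReal.toReal_mono (Lp.eLpNorm_ne_top h)
      (eLpNorm_mul_le hm hle hac (Lp.aestronglyMeasurable h))

section mulCLM

variable {μ ν : Measure Circle1} {m : Circle1 → ℂ} (hm : AEStronglyMeasurable m ν)
    (hle : ν.withDensity (fun t => ‖m t‖ₑ ^ 2) ≤ μ) (hac : ν ≪ μ)

lemma coeFn_mulCLM (h : Lp ℂ 2 μ) : mulCLM m hm hle hac h =ᵐ[ν] fun t => h t * m t :=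
  (memLp_mul hm hle hac (Lp.memLp h)).coeFn_toLp

lemma norm_mulCLM_le (h : Lp ℂ 2 μ) : ‖mulCLM m hm hle hac h‖ ≤ ‖h‖ := by
  refine (ContinuousLinearMap.le_of_opNorm_le _
    (LinearMap.mkContinuous_norm_le _ zero_le_one _) h).trans_eq (one_mul _)

lemma mulCLM_toLp {f : Circle1 → ℂ} (hf : MemLp f 2 μ) :
    mulCLM m hm hle hac (hf.toLp f) = (memLp_mul hm hle hac hf).toLp _ := by
  refine (MemLp.toLp_eq_toLp_iff (memLp_mul hm hle hac (Lp.memLp _)) _).2 ?_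
  filter_upwards [hac.ae_le hf.coeFn_toLp] with t ht
  rw [ht]

end mulCLM

lemma inner_Lp_eq_integral {ν : Measure Circle1} (f g : Lp ℂ 2 ν) :
    inner ℂ f g = ∫ t, g t * conj (f t) ∂ν := by
  rw [L2.inner_def]
  rfl

/-! ### The exponentials and the shift in `L²(μ)` -/

lemma withDensity_enorm_fourier (μ : Measure Circle1) (k : ℤ) :
    μ.withDensity (fun t => ‖(fourier k t : ℂ)‖ₑ ^ 2) = μ := by
  have : (fun t : Circle1 => ‖(fourier k t : ℂ)‖ₑ ^ 2) = 1 := by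
    funext t
    rw [← ofReal_norm, norm_fourier_apply]
    simp
  rw [this, withDensity_one]

section shift

variable (μ : Measure Circle1)

/-- Multiplication by `e_k` on `L²(μ)`. -/
noncomputable def shift (k : ℤ) : Lp ℂ 2 μ →L[ℂ] Lp ℂ 2 μ :=
  mulCLM (fun t => fourier k t) (fourier k).continuous.aestronglyMeasurable
    (withDensity_enorm_fourier μ k).le (Measure.AbsolutelyContinuous.refl μ)

lemma coeFn_shift (k : ℤ) (h : Lp ℂ 2 μ) : shift μ k h =ᵐ[μ] fun t => h t * fourier k t :=
  coeFn_mulCLM _ _ _ h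

lemma inner_shift (k : ℤ) (x y : Lp ℂ 2 μ) :
    inner ℂ (shift μ k x) y = inner ℂ x (shift μ (-k) y) := by
  rw [inner_Lp_eq_integral, inner_Lp_eq_integral]
  refine integral_congr_ae ?_
  filter_upwards [coeFn_shift μ k x, coeFn_shift μ (-k) y] with t h1 h2
  rw [h1, h2, map_mul, fourier_neg]
  ring

variable [IsFiniteMeasure μ]

lemma memLp_fourier (n : ℤ) : MemLp (fun t : Circle1 => (fourier n t : ℂ)) 2 μ :=
  (fourier n).continuous.memLp_of_hasCompactSupport (HasCompactSupport.of_compactSpace _)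

/-- The exponential `e_n` as an element of `L²(μ)`. -/
noncomputable def expLp (n : ℤ) : Lp ℂ 2 μ := (memLp_fourier μ n).toLp _

lemma coeFn_expLp (n : ℤ) : expLp μ n =ᵐ[μ] fun t => (fourier n t : ℂ) :=
  (memLp_fourier μ n).coeFn_toLp

lemma shift_expLp (k j : ℤ) : shift μ k (expLp μ j) = expLp μ (j + k) := by
  refine Lp.ext ?_
  filter_upwards [coeFn_shift μ k (expLp μ j), coeFn_expLp μ j, coeFn_expLp μ (j + k)]
    with t h1 h2 h3
  rw [h1, h2, h3, fourier_add]

lemma inner_expLp (n : ℤ) (x : Lp ℂ 2 μ) :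
    inner ℂ (expLp μ n) x = ∫ t, x t * fourier (-n) t ∂μ := by
  rw [inner_Lp_eq_integral]
  refine integral_congr_ae ?_
  filter_upwards [coeFn_expLp μ n] with t h1
  rw [h1, fourier_neg]

/-- Trigonometric polynomials are dense in `L²(μ)`. -/
lemma eq_zero_of_inner_expLp {x : Lp ℂ 2 μ} (hx : ∀ n, inner ℂ (expLp μ n) x = 0) : x = 0 := by
  have hd := (ContinuousMap.toLp_denseRange ℂ μ ℂ (p := 2)
    ENNReal.ofNat_ne_top).topologicalClosure_map_submodule
      (span_fourier_closure_eq_top (T := (1 : ℝ)))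
  rw [Submodule.map_span] at hd
  have hmem : ∀ y ∈ (Submodule.span ℂ ((ContinuousMap.toLp 2 μ ℂ : C(Circle1, ℂ) →L[ℂ] _) ''
      Set.range (@fourier (1 : ℝ)))), inner ℂ y x = 0 := by
    intro y hy
    induction hy using Submodule.span_induction with
    | mem y hy =>
      obtain ⟨_, ⟨n, rfl⟩, rfl⟩ := hy
      convert hx n using 2
      refine Lp.ext ?_
      filter_upwards [coeFn_expLp μ n, ContinuousMap.coeFn_toLp (𝕜 := ℂ) μ (p := 2) (fourier n)]
        with t h1 h2
      rw [h1]
      exact h2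
    | zero => exact inner_zero_left _
    | add y z _ _ h1 h2 => rw [inner_add_left, h1, h2, add_zero]
    | smul c y _ h1 => rw [inner_smul_left, h1, mul_zero]
  have h0 := Submodule.topologicalClosure_eq_top_iff.1 hd
  have hx' : x ∈ (Submodule.span ℂ ((ContinuousMap.toLp 2 μ ℂ : C(Circle1, ℂ) →L[ℂ] _) ''
      Set.range (@fourier (1 : ℝ))))ᗮ := hmem
  exact (Submodule.mem_bot ℂ).1 (h0.le hx')

/-! ### The past and the innovation -/

/-- The span of `e_{-1}, …, e_{-n}` in `L²(μ)`. -/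
noncomputable def pastFin (n : ℕ) : Submodule ℂ (Lp ℂ 2 μ) :=
  Submodule.span ℂ (Set.range fun i : Fin n => expLp μ (-((i : ℤ) + 1)))

instance (n : ℕ) : FiniteDimensional ℂ (pastFin μ n) :=
  FiniteDimensional.span_of_finite ℂ (Set.finite_range _)

lemma pastFin_mono : Monotone (pastFin μ) := fun _ _ hnm =>
  Submodule.span_mono (Set.range_subset_iff.2 fun i => ⟨i.castLE hnm, rfl⟩)

/-- The closed span of `e_{-1}, e_{-2}, …` in `L²(μ)`. -/
noncomputable def past : Submodule ℂ (Lp ℂ 2 μ) := (⨆ n, pastFin μ n).topologicalClosure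

instance : CompleteSpace (past μ) :=
  (Submodule.isClosed_topologicalClosure _).completeSpace_coe

lemma expLp_mem_past {j : ℤ} (hj : j < 0) : expLp μ j ∈ past μ := by
  refine Submodule.le_topologicalClosure _
    (Submodule.mem_iSup_of_mem ((-j).toNat) (Submodule.subset_span ⟨⟨(-j).toNat - 1, ?_⟩, ?_⟩))
  · omega
  · dsimp only
    congr 1
    omega

lemma past_le {K : Submodule ℂ (Lp ℂ 2 μ)} (hK : IsClosed (K : Set (Lp ℂ 2 μ)))
    (h : ∀ j : ℤ, j < 0 → expLp μ j ∈ K) : past μ ≤ K := by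
  refine Submodule.topologicalClosure_minimal _ (iSup_le fun n => Submodule.span_le.2 ?_) hK
  rintro _ ⟨i, rfl⟩
  exact h _ (by omega)

lemma mem_past_orthogonal {x : Lp ℂ 2 μ} (h : ∀ j : ℤ, j < 0 → inner ℂ (expLp μ j) x = 0) :
    x ∈ (past μ)ᗮ := by
  have : past μ ≤ (ℂ ∙ x)ᗮ := past_le μ (Submodule.isClosed_orthogonal _) fun j hj =>
    Submodule.mem_orthogonal_singleton_iff_inner_left.2 (h j hj)
  intro y hy
  exact Submodule.mem_orthogonal_singleton_iff_inner_left.1 (this hy)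

/-- A vector orthogonal to all `e_j`, `j < k`, is orthogonal to the products of `e_k` with the
past. -/
lemma inner_past_shift {x : Lp ℂ 2 μ} {k : ℤ}
    (h : ∀ j : ℤ, j < k → inner ℂ (expLp μ j) x = 0) {y : Lp ℂ 2 μ} (hy : y ∈ past μ) :
    inner ℂ (shift μ k y) x = 0 := by
  rw [inner_shift]
  refine mem_past_orthogonal μ (fun j hj => ?_) y hy
  rw [← inner_shift, shift_expLp]
  exact h _ (by omega)

/-- The component of `e_0` orthogonal to `e_{-1}, e_{-2}, …`. -/
noncomputable def innovation : Lp ℂ 2 μ := expLp μ 0 - (past μ).starProjection (expLp μ 0)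

lemma innovation_mem : innovation μ ∈ (past μ)ᗮ :=
  Submodule.sub_starProjection_mem_orthogonal _

lemma inner_expLp_innovation {j : ℤ} (hj : j < 0) : inner ℂ (expLp μ j) (innovation μ) = 0 :=
  innovation_mem μ _ (expLp_mem_past μ hj)

lemma inner_expLp_zero_innovation :
    inner ℂ (expLp μ 0) (innovation μ) = (‖innovation μ‖ : ℂ) ^ 2 := by
  have h : expLp μ 0 = innovation μ + (past μ).starProjection (expLp μ 0) :=
    (sub_add_cancel _ _).symm
  rw [h, inner_add_left, inner_self_eq_norm_sq_to_K,
    innovation_mem μ _ (Submodule.starProjection_apply_mem _ _), add_zero]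
  rfl

lemma shift_innovation (k : ℤ) : shift μ k (innovation μ)
    = expLp μ k - shift μ k ((past μ).starProjection (expLp μ 0)) := by
  rw [innovation, map_sub, shift_expLp, zero_add]

/-- The translates of the innovation are orthogonal. -/
lemma inner_shift_innovation {k : ℤ} (hk : k ≠ 0) :
    inner ℂ (shift μ k (innovation μ)) (innovation μ) = 0 := by
  have key : ∀ k : ℤ, k < 0 → inner ℂ (shift μ k (innovation μ)) (innovation μ) = 0 := by
    intro k hk
    rw [shift_innovation, inner_sub_left, inner_expLp_innovation μ hk, inner_past_shift μ
      (fun j hj => inner_expLp_innovation μ (hj.trans hk))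
      (Submodule.starProjection_apply_mem _ _), sub_zero]
  rcases lt_or_gt_of_ne hk with h | h
  · exact key k h
  · rw [inner_shift, ← inner_conj_symm, key (-k) (by omega), map_zero]

/-- The closed span of `e_k w`, `k ≥ 0`, for the innovation `w`. -/
noncomputable def future : Submodule ℂ (Lp ℂ 2 μ) :=
  (Submodule.span ℂ (Set.range fun k : ℕ => shift μ k (innovation μ))).topologicalClosure

instance : CompleteSpace (future μ) :=
  (Submodule.isClosed_topologicalClosure _).completeSpace_coe

lemma future_le {K : Submodule ℂ (Lp ℂ 2 μ)} (hK : IsClosed (K : Set (Lp ℂ 2 μ)))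
    (h : ∀ k : ℕ, shift μ k (innovation μ) ∈ K) : future μ ≤ K := by
  refine Submodule.topologicalClosure_minimal _ (Submodule.span_le.2 ?_) hK
  rintro _ ⟨k, rfl⟩
  exact h k

lemma shift_innovation_mem_future (k : ℕ) : shift μ k (innovation μ) ∈ future μ :=
  Submodule.le_topologicalClosure _ (Submodule.subset_span ⟨k, rfl⟩)

lemma future_le_past_orthogonal : future μ ≤ (past μ)ᗮ :=
  future_le μ (Submodule.isClosed_orthogonal _) fun k => mem_past_orthogonal μ fun j hj => by
    rw [← inner_conj_symm, inner_shift, ← inner_conj_symm, shift_expLp,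
      inner_expLp_innovation μ (by omega), map_zero, map_zero]

/-- **Wold decomposition**: the orthogonal complement of the past is spanned by the translates
`e_k w`, `k ≥ 0`, of the innovation. -/
lemma past_orthogonal_le_future : (past μ)ᗮ ≤ future μ := by
  have key : ∀ x ∈ (past μ)ᗮ, x ∈ (future μ)ᗮ → x = 0 := by
    intro x hp hf
    have hn : ∀ n : ℕ, ∀ j : ℤ, j < n → inner ℂ (expLp μ j) x = 0 := by
      intro n
      induction n with
      | zero => exact fun j hj => hp _ (expLp_mem_past μ (by simpa using hj))
      | succ n ih =>
        intro j hj
        rcases lt_or_eq_of_le (show j ≤ n by push_cast at hj; omega) with h | rfl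
        · exact ih j h
        · have h1 := hf _ (shift_innovation_mem_future μ n)
          rw [shift_innovation, inner_sub_left,
            inner_past_shift μ ih (Submodule.starProjection_apply_mem _ _), sub_zero] at h1
          exact h1
    exact eq_zero_of_inner_expLp μ fun n => hn (n.toNat + 1) n (by omega)
  intro x hx
  have h := key (x - (future μ).starProjection x)
    (sub_mem hx (future_le_past_orthogonal μ (Submodule.starProjection_apply_mem _ _)))
    (Submodule.sub_starProjection_mem_orthogonal _)
  rw [sub_eq_zero.1 h]
  exact Submodule.starProjection_apply_mem _ _

end shift

/-! ### The innovation and the density -/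

/-- Finite measures on the circle are determined by their Fourier coefficients. -/
lemma measure_ext_of_integral_fourier {ν ν' : Measure Circle1} [IsFiniteMeasure ν]
    [IsFiniteMeasure ν'] (h : ∀ n : ℤ, ∫ t, (fourier n t : ℂ) ∂ν = ∫ t, (fourier n t : ℂ) ∂ν') :
    ν = ν' := by
  refine ext_of_forall_mem_subalgebra_integral_eq_of_pseudoEMetric_complete_countable (𝕜 := ℂ)
    (A := (fourierSubalgebra (T := (1 : ℝ))).comap
      (BoundedContinuousFunction.toContinuousMapStarₐ ℂ)) ?_ ?_
  · intro x y hxy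
    obtain ⟨_, ⟨f, hf, rfl⟩, hne⟩ := fourierSubalgebra_separatesPoints (T := (1 : ℝ)) hxy
    refine ⟨f, ⟨f, ⟨BoundedContinuousFunction.mkOfCompact f, ?_, ?_⟩, rfl⟩, hne⟩
    · exact hf
    · rfl
  · intro g hg
    have hg' : (g : C(Circle1, ℂ)) ∈ Submodule.span ℂ (Set.range (@fourier (1 : ℝ))) := by
      rw [← fourierSubalgebra_coe]
      exact hg
    have hi : ∀ (κ : Measure Circle1) [IsFiniteMeasure κ] (f : C(Circle1, ℂ)), Integrable f κ :=
      fun κ _ f => f.continuous.integrable_of_hasCompactSupport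
        (HasCompactSupport.of_compactSpace _)
    have key : ∀ f ∈ Submodule.span ℂ (Set.range (@fourier (1 : ℝ))),
        ∫ t, f t ∂ν = ∫ t, f t ∂ν' := by
      intro f hf
      induction hf using Submodule.span_induction with
      | mem f hf =>
        obtain ⟨n, rfl⟩ := hf
        exact h n
      | zero => simp
      | add f g _ _ h1 h2 =>
        simp only [ContinuousMap.add_apply]
        rw [integral_add (hi ν f) (hi ν g), integral_add (hi ν' f) (hi ν' g), h1, h2]
      | smul c f _ h1 =>
        simp only [ContinuousMap.smul_apply]
        rw [integral_smul, integral_smul, h1]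
    exact key _ hg'

lemma acDensity_nonneg (μ : Measure Circle1) (t : Circle1) : 0 ≤ acDensity μ t := ENNReal.toReal_nonneg

lemma measurable_acDensity (μ : Measure Circle1) : Measurable (acDensity μ) :=
  (Measure.measurable_rnDeriv μ leb).ennreal_toReal

section

variable (μ : Measure Circle1) [IsFiniteMeasure μ]

lemma integral_leb_fourier (n : ℤ) :
    ∫ t : Circle1, (fourier n t : ℂ) ∂leb = if n = 0 then 1 else 0 := by
  have h := fourierCoeff_fourier_apply n 0
  rw [fourierCoeff] at h
  simp only [neg_zero, fourier_zero, one_smul] at h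
  rw [h]
  simp only [eq_comm]

/-- `|w|² μ` is a multiple of Lebesgue measure, `w` being the innovation. -/
lemma withDensity_innovation :
    μ.withDensity (fun t => ‖innovation μ t‖ₑ ^ 2)
      = ENNReal.ofReal (‖innovation μ‖ ^ 2) • leb := by
  set w := innovation μ with hw
  have hmeas : AEStronglyMeasurable w μ := Lp.aestronglyMeasurable w
  have hfin : ∫⁻ t, ‖w t‖ₑ ^ 2 ∂μ ≠ ∞ := by
    have := (Lp.memLp w).2
    rw [eLpNorm_two_eq] at this
    intro h
    simp [h] at this
  have : IsFiniteMeasure (μ.withDensity fun t => ‖w t‖ₑ ^ 2) :=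
    isFiniteMeasure_withDensity hfin
  have : IsFiniteMeasure (ENNReal.ofReal (‖w‖ ^ 2) • (leb : Measure Circle1)) :=
    Measure.smul_finite _ ENNReal.ofReal_ne_top
  refine measure_ext_of_integral_fourier fun n => ?_
  have h1 : ∫ t, (fourier n t : ℂ) ∂(μ.withDensity fun t => ‖w t‖ₑ ^ 2)
      = inner ℂ w (shift μ n w) := by
    rw [integral_withDensity_eq_integral_toReal_smul₀ (hmeas.enorm.pow_const 2)
      (Eventually.of_forall fun t => by simp), inner_Lp_eq_integral]
    refine integral_congr_ae ?_
    filter_upwards [coeFn_shift μ n w] with t ht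
    rw [ht, ENNReal.toReal_pow, toReal_enorm, Complex.real_smul, Complex.ofReal_pow,
      ← Complex.mul_conj']
    ring
  rw [h1, integral_smul_measure, integral_leb_fourier]
  by_cases hn : n = 0
  · have h0 : shift μ 0 w = w := by
      refine Lp.ext ?_
      filter_upwards [coeFn_shift μ 0 w] with t ht
      rw [ht, fourier_zero, mul_one]
    rw [hn, h0, if_pos rfl, inner_self_eq_norm_sq_to_K,
      ENNReal.toReal_ofReal (by positivity), Complex.real_smul, mul_one]
    push_cast
    rfl
  · rw [if_neg hn, smul_zero, ← inner_conj_symm, inner_shift_innovation μ hn, map_zero]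

lemma innovation_ae_singularPart : ∀ᵐ t ∂(μ.singularPart leb), innovation μ t = 0 := by
  obtain ⟨S, hS, h1, h2⟩ := μ.mutuallySingular_singularPart leb
  -- `S` is null for the singular part, its complement for Lebesgue measure
  have h3 : (μ.withDensity fun t => ‖innovation μ t‖ₑ ^ 2) Sᶜ = 0 := by
    rw [withDensity_innovation, Measure.smul_apply, h2, smul_zero]
  rw [withDensity_apply _ hS.compl, lintegral_eq_zero_iff'
    ((Lp.aestronglyMeasurable _).enorm.pow_const 2).restrict] at h3
  have h4 : ∀ᵐ t ∂(μ.singularPart leb).restrict Sᶜ, innovation μ t = 0 := by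
    have h5 := Measure.restrict_mono_measure (μ.singularPart_le leb) Sᶜ
    filter_upwards [ae_mono h5 h3] with t ht
    simpa using ht
  rw [ae_restrict_iff' hS.compl] at h4
  have h6 : ∀ᵐ t ∂(μ.singularPart leb), t ∈ Sᶜ := by
    rw [ae_iff]
    simpa using h1
  filter_upwards [h4, h6] with t h7 h8 using h7 h8

lemma integrable_acDensity : Integrable (acDensity μ) leb := Measure.integrable_toReal_rnDeriv

/-- Only the absolutely continuous part counts for a function that vanishes almost everywhere for
the singular part. -/
lemma integral_eq_integral_acDensity {q : Circle1 → ℂ} (hq : Integrable q μ)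
    (h0 : ∀ᵐ t ∂(μ.singularPart leb), q t = 0) :
    ∫ t, q t ∂μ = ∫ t, (acDensity μ t : ℂ) * q t ∂leb := by
  have hd := Measure.haveLebesgueDecomposition_add μ leb
  have h1 : Integrable q (μ.singularPart leb) := hq.mono_measure (μ.singularPart_le leb)
  have h2 : Integrable q (leb.withDensity (μ.rnDeriv leb)) :=
    hq.mono_measure (Measure.withDensity_rnDeriv_le μ leb)
  calc ∫ t, q t ∂μ = ∫ t, q t ∂(μ.singularPart leb + leb.withDensity (μ.rnDeriv leb)) := by
        rw [← hd]
    _ = ∫ t, q t ∂(leb.withDensity (μ.rnDeriv leb)) := by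
        rw [integral_add_measure h1 h2, integral_eq_zero_of_ae h0, zero_add]
    _ = _ := by
        rw [integral_withDensity_eq_integral_toReal_smul (Measure.measurable_rnDeriv μ leb)
          (Measure.rnDeriv_lt_top μ leb)]
        rfl

lemma norm_innovation_sq_mul_acDensity :
    ∀ᵐ t ∂leb, ‖innovation μ t‖ ^ 2 * acDensity μ t = ‖innovation μ‖ ^ 2 := by
  set W : Circle1 → ℝ≥0∞ := fun t => ‖innovation μ t‖ₑ ^ 2 with hW
  have hw : Measurable W :=
    (Lp.stronglyMeasurable (innovation μ)).measurable.enorm.pow_const 2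
  have h0 : (μ.singularPart leb).withDensity W = 0 := by
    rw [← withDensity_zero]
    refine withDensity_congr_ae ?_
    filter_upwards [innovation_ae_singularPart μ] with t ht
    simp [hW, ht]
  have h1 : μ.withDensity W = leb.withDensity (μ.rnDeriv leb * W) := by
    clear_value W
    conv_lhs => rw [Measure.haveLebesgueDecomposition_add μ leb]
    rw [withDensity_add_measure, h0, zero_add,
      withDensity_mul _ (Measure.measurable_rnDeriv μ leb) hw]
  rw [hW, withDensity_innovation, ← withDensity_const, withDensity_eq_iff aemeasurable_const
    ((Measure.measurable_rnDeriv μ leb).mul hw).aemeasurable (by simp)] at h1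
  filter_upwards [h1] with t ht
  have h2 := congrArg ENNReal.toReal ht
  rw [ENNReal.toReal_ofReal (by positivity), Pi.mul_apply, ENNReal.toReal_mul, ENNReal.toReal_pow,
    toReal_enorm, mul_comm] at h2
  exact h2.symm

variable {μ}

lemma ae_acDensity_pos (hw : innovation μ ≠ 0) : ∀ᵐ t ∂leb, 0 < acDensity μ t := by
  filter_upwards [norm_innovation_sq_mul_acDensity μ] with t ht
  refine lt_of_le_of_ne (acDensity_nonneg μ t) fun h => ?_
  rw [← h, mul_zero] at ht
  exact hw (norm_eq_zero.1 (pow_eq_zero_iff two_ne_zero |>.1 ht.symm))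

omit [IsFiniteMeasure μ] in
lemma leb_absolutelyContinuous (h : ∀ᵐ t ∂leb, 0 < acDensity μ t) : leb ≪ μ := by
  refine (withDensity_absolutelyContinuous' (Measure.measurable_rnDeriv μ leb).aemeasurable
    ?_).trans (Measure.absolutelyContinuous_of_le (Measure.withDensity_rnDeriv_le μ leb))
  filter_upwards [h] with t ht h0
  rw [acDensity, h0] at ht
  simp at ht

/-- Parseval's identity for a product with only one common frequency. -/
lemma integral_mul_eq_of_fourierCoeff {F G : Circle1 → ℂ} (hF : MemLp F 2 leb)
    (hG : MemLp G 2 leb) (hF0 : ∀ n : ℤ, n < 0 → fourierCoeff F n = 0)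
    (hG0 : ∀ n : ℤ, n < 0 → fourierCoeff G n = 0) :
    ∫ t, F t * G t ∂leb = fourierCoeff F 0 * fourierCoeff G 0 := by
  have hG' : MemLp (fun t => conj (G t)) 2 leb := hG.star
  have h := (fourierBasis (T := (1 : ℝ))).tsum_inner_mul_inner (hG'.toLp _) (hF.toLp F)
  have h1 : ∀ n, inner ℂ (fourierBasis n) (hF.toLp F) = fourierCoeff F n := fun n => by
    rw [← HilbertBasis.repr_apply_apply, fourierBasis_repr]
    exact congrFun (fourierCoeff_congr_ae hF.coeFn_toLp) n
  have h2 : ∀ n, inner ℂ (hG'.toLp _) (fourierBasis n) = fourierCoeff G (-n) := fun n => by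
    rw [← inner_conj_symm, ← HilbertBasis.repr_apply_apply, fourierBasis_repr,
      congrFun (fourierCoeff_congr_ae hG'.coeFn_toLp) n, fourierCoeff, fourierCoeff,
      ← integral_conj]
    congr 1 with t
    rw [smul_eq_mul, smul_eq_mul, map_mul, Complex.conj_conj, ← fourier_neg]
  simp_rw [h1, h2] at h
  rw [tsum_eq_single 0 (fun n hn => by
    rcases lt_or_gt_of_ne hn with hn | hn
    · rw [hF0 n hn, mul_zero]
    · rw [hG0 (-n) (by omega), zero_mul]), neg_zero, inner_Lp_eq_integral] at h
  rw [mul_comm, h]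
  refine integral_congr_ae ?_
  filter_upwards [hF.coeFn_toLp, hG'.coeFn_toLp] with t h3 h4
  rw [h3, h4, Complex.conj_conj]

omit [IsFiniteMeasure μ] in
lemma logIntegrable_inv_add {D : Circle1 → ℝ} (hD : Measurable D) (h0 : ∀ t, 0 ≤ D t)
    (hi : Integrable D leb) {ε : ℝ} (hε : 0 < ε) :
    LogIntegrable (fun t => (D t + ε)⁻¹) ∧ Integrable (fun t => (D t + ε)⁻¹) leb := by
  have hpos : ∀ t, 0 < D t + ε := fun t => add_pos_of_nonneg_of_pos (h0 t) hε
  refine ⟨⟨Eventually.of_forall fun t => inv_pos.2 (hpos t), ?_⟩, ?_⟩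
  · refine ((hi.add (integrable_const (ε + |Real.log ε|))).mono'
      (Real.measurable_log.comp (hD.add_const ε).inv).aestronglyMeasurable
      (Eventually.of_forall fun t => ?_))
    rw [Real.log_inv, norm_neg, Real.norm_eq_abs, abs_le]
    have h1 : Real.log ε ≤ Real.log (D t + ε) := Real.log_le_log hε (by linarith [h0 t])
    have h2 := Real.log_le_sub_one_of_pos (hpos t)
    have h3 := neg_abs_le (Real.log ε)
    have h4 := abs_nonneg (Real.log ε)
    have := h0 t
    simp only [Pi.add_apply]
    constructor <;> linarith
  · refine (integrable_const ε⁻¹).mono' (by fun_prop) (Eventually.of_forall fun t => ?_)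
    rw [Real.norm_of_nonneg (inv_pos.2 (hpos t)).le]
    exact inv_anti₀ hε (by linarith [h0 t])

/-- The function `w D` is in `H²`; pairing it with the outer function of `1 / (D + ε)` bounds the
distance of `e_0` from the past. -/
lemma log_norm_innovation_le (hw : innovation μ ≠ 0) {ε : ℝ} (hε : 0 < ε) :
    Real.log (‖innovation μ‖ ^ 2) ≤ ∫ t, Real.log (acDensity μ t + ε) ∂leb := by
  have hDpos := ae_acDensity_pos hw
  set w := innovation μ with hwdef
  set D := acDensity μ with hDdef
  have hD0 := acDensity_nonneg μ
  have hnorm := norm_innovation_sq_mul_acDensity μ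
  have hmeas : Measurable w := (Lp.stronglyMeasurable w).measurable
  have hmD := measurable_acDensity μ
  set ψ : Circle1 → ℂ := fun t => (D t : ℂ) * w t with hψ
  have hψ2 : ∀ᵐ t ∂leb, ‖ψ t‖ ^ 2 = ‖w‖ ^ 2 * D t := by
    filter_upwards [hnorm] with t ht
    rw [hψ, norm_mul, Complex.norm_real, Real.norm_of_nonneg (hD0 t), mul_pow, ← ht]
    ring
  have hmψ : MemLp ψ 2 leb := by
    have hm : Measurable ψ := (Complex.measurable_ofReal.comp hmD).mul hmeas
    rw [memLp_two_iff_integrable_sq_norm hm.aestronglyMeasurable]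
    exact ((integrable_acDensity μ).const_mul _).congr (by filter_upwards [hψ2] with t ht using ht.symm)
  -- the singular part of `μ` does not contribute, as `w` vanishes there
  have hcoef : ∀ n : ℤ, fourierCoeff ψ n = inner ℂ (expLp μ n) w := by
    intro n
    have hi : Integrable (fun t => w t * fourier (-n) t) μ := by
      refine (integrable_coe_Lp (shift μ (-n) w)).congr (coeFn_shift μ (-n) w)
    rw [inner_expLp, integral_eq_integral_acDensity μ hi (by
      filter_upwards [innovation_ae_singularPart μ] with t ht
      rw [ht, zero_mul]), fourierCoeff]
    congr 1 with t
    rw [smul_eq_mul, hψ]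
    ring
  obtain ⟨hv, hvi⟩ := logIntegrable_inv_add hmD hD0 (integrable_acDensity μ) hε
  obtain ⟨F, -, hF1, hF2, hF3⟩ := exists_outerFn_ae_eq hv hvi
  have hpair := integral_mul_eq_of_fourierCoeff hmψ (Lp.memLp F)
    (fun n hn => by rw [hcoef, inner_expLp_innovation μ hn]) hF2
  rw [hcoef, inner_expLp_zero_innovation, hF3] at hpair
  -- pointwise, `|ψ F|² = ‖w‖² D / (D + ε)`
  have hbound : ‖∫ t, ψ t * F t ∂leb‖ ≤ ‖w‖ := by
    have := norm_integral_le_of_norm_le_const (μ := leb) (f := fun t => ψ t * F t) (C := ‖w‖) (by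
      filter_upwards [hψ2, hF1] with t h1 h2
      refine abs_le_of_sq_le_sq' ?_ (norm_nonneg _) |>.2
      rw [norm_mul, mul_pow, h1, h2, mul_assoc]
      refine mul_le_of_le_one_right (by positivity) ?_
      rw [← div_eq_mul_inv]
      exact div_le_one_of_le₀ (by linarith) (by linarith [hD0 t]))
    simpa using this
  have hwpos : 0 < ‖w‖ := norm_pos_iff.2 hw
  have hlog : ∀ t, Real.log (D t + ε)⁻¹ = - Real.log (D t + ε) := fun t => Real.log_inv _
  rw [hpair] at hbound
  rw [integral_congr_ae (Eventually.of_forall hlog), integral_neg] at hbound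
  rw [← Complex.ofReal_pow, ← Complex.ofReal_mul, Complex.norm_real,
    Real.norm_of_nonneg (by positivity)] at hbound
  have h1 : ‖w‖ * Real.exp (1 / 2 * -∫ t, Real.log (D t + ε) ∂leb) ≤ 1 := by
    refine le_of_mul_le_mul_left ?_ hwpos
    calc _ = ‖w‖ ^ 2 * Real.exp (1 / 2 * -∫ t, Real.log (D t + ε) ∂leb) := by ring
      _ ≤ _ := by rw [mul_one]; exact hbound
  have h2 := Real.log_le_log (by positivity) h1
  rw [Real.log_mul hwpos.ne' (Real.exp_pos _).ne', Real.log_exp, Real.log_one] at h2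
  rw [Real.log_pow]
  push_cast
  linarith

omit [IsFiniteMeasure μ] in
/-- Fatou's lemma for `log (D + ε)` as `ε ↓ 0`. -/
lemma integrable_log_of_forall_le {D : Circle1 → ℝ} (hD : Measurable D) (h0 : ∀ t, 0 ≤ D t)
    (hi : Integrable D leb) (hpos : ∀ᵐ t ∂leb, 0 < D t) {L : ℝ}
    (hL : ∀ ε : ℝ, 0 < ε → L ≤ ∫ t, Real.log (D t + ε) ∂leb) :
    Integrable (fun t => Real.log (D t)) leb ∧ L ≤ ∫ t, Real.log (D t) ∂leb := by
  set e : ℕ → ℝ := fun n => 1 / ((n : ℝ) + 1) with he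
  have he0 : ∀ n, 0 < e n := fun n => Nat.one_div_pos_of_nat
  have he1 : ∀ n, e n ≤ 1 := fun n => by
    rw [he, div_le_one (by positivity)]
    linarith [Nat.cast_nonneg (α := ℝ) n]
  set u : Circle1 → ℝ := fun t => D t + 1 - Real.log (D t) with hu
  set un : ℕ → Circle1 → ℝ := fun n t => D t + 1 - Real.log (D t + e n) with hun
  have hD1 : Integrable (fun t => D t + 1) leb := hi.add (integrable_const 1)
  have hlogn : ∀ n, Integrable (fun t => Real.log (D t + e n)) leb := fun n => by
    have := (logIntegrable_inv_add hD h0 hi (he0 n)).1.2.neg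
    refine this.congr (Eventually.of_forall fun t => ?_)
    simp [Real.log_inv]
  have hun0 : ∀ n t, 0 ≤ un n t := fun n t => by
    have := Real.log_le_sub_one_of_pos (add_pos_of_nonneg_of_pos (h0 t) (he0 n))
    have := he1 n
    simp only [hun]
    linarith
  have hu0 : 0 ≤ᵐ[leb] u := by
    filter_upwards [hpos] with t ht
    have := Real.log_le_sub_one_of_pos ht
    simp only [hu, Pi.zero_apply]
    linarith
  have hiun : ∀ n, Integrable (un n) leb := fun n => hD1.sub (hlogn n)
  have hIn : ∀ n, ∫ t, un n t ∂leb ≤ ∫ t, (D t + 1) ∂leb - L := fun n => by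
    rw [hun, integral_sub hD1 (hlogn n)]
    linarith [hL _ (he0 n)]
  have hmu : Measurable u := by fun_prop
  have hlim : ∀ᵐ t ∂leb, Tendsto (fun n => ENNReal.ofReal (un n t)) atTop
      (𝓝 (ENNReal.ofReal (u t))) := by
    filter_upwards [hpos] with t ht
    refine ENNReal.tendsto_ofReal (tendsto_const_nhds.sub ?_)
    have h1 : Tendsto (fun n => D t + e n) atTop (𝓝 (D t + 0)) :=
      tendsto_const_nhds.add tendsto_one_div_add_atTop_nhds_zero_nat
    rw [add_zero] at h1
    exact (Real.continuousAt_log ht.ne').tendsto.comp h1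
  have hfatou : ∫⁻ t, ENNReal.ofReal (u t) ∂leb ≤ ENNReal.ofReal (∫ t, (D t + 1) ∂leb - L) := by
    calc ∫⁻ t, ENNReal.ofReal (u t) ∂leb
        = ∫⁻ t, liminf (fun n => ENNReal.ofReal (un n t)) atTop ∂leb := by
          refine lintegral_congr_ae ?_
          filter_upwards [hlim] with t ht using ht.liminf_eq.symm
      _ ≤ liminf (fun n => ∫⁻ t, ENNReal.ofReal (un n t) ∂leb) atTop :=
          lintegral_liminf_le fun n => by fun_prop
      _ ≤ ENNReal.ofReal (∫ t, (D t + 1) ∂leb - L) := by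
          refine liminf_le_of_le (by isBoundedDefault) fun b hb => ?_
          obtain ⟨n, hn⟩ := hb.exists
          refine hn.trans ?_
          rw [← ofReal_integral_eq_lintegral_ofReal (hiun n) (Eventually.of_forall (hun0 n))]
          exact ENNReal.ofReal_le_ofReal (hIn n)
  have hiu : Integrable u leb := by
    refine ⟨hmu.aestronglyMeasurable, ?_⟩
    rw [hasFiniteIntegral_iff_ofReal hu0]
    exact hfatou.trans_lt ENNReal.ofReal_lt_top
  have hilog : Integrable (fun t => Real.log (D t)) leb := by
    refine (hD1.sub hiu).congr (Eventually.of_forall fun t => ?_)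
    simp [hu]
  refine ⟨hilog, ?_⟩
  have hB : 0 ≤ ∫ t, (D t + 1) ∂leb - L := (integral_nonneg (hun0 0)).trans (hIn 0)
  have h1 : ∫ t, u t ∂leb ≤ ∫ t, (D t + 1) ∂leb - L := by
    rw [← ofReal_integral_eq_lintegral_ofReal hiu hu0] at hfatou
    exact (ENNReal.ofReal_le_ofReal_iff hB).1 hfatou
  rw [hu, integral_sub hD1 hilog] at h1
  linarith

/-- **Szegő's theorem**, upper bound: if `e_0` is not in the past then `log D` is integrable, and
the squared distance is at most its geometric mean. -/
theorem logIntegrable_of_innovation_ne_zero (hw : innovation μ ≠ 0) :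
    LogIntegrable (acDensity μ) ∧
      ‖innovation μ‖ ≤ Real.exp (1 / 2 * ∫ t, Real.log (acDensity μ t) ∂leb) := by
  have hpos := ae_acDensity_pos hw
  obtain ⟨h1, h2⟩ := integrable_log_of_forall_le (measurable_acDensity μ) (acDensity_nonneg μ)
    (integrable_acDensity μ) hpos fun ε hε => log_norm_innovation_le hw hε
  refine ⟨⟨hpos, h1⟩, ?_⟩
  rw [← Real.log_le_iff_le_exp (norm_pos_iff.2 hw)]
  rw [Real.log_pow] at h2
  push_cast at h2
  linarith

end

/-! ### The passage from `L²(μ)` to the Hardy space -/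

lemma fourierCoeff_eq_inner (x : Lp ℂ 2 leb) (n : ℤ) :
    fourierCoeff x n = inner ℂ (expLp leb n) x := by
  rw [inner_expLp, fourierCoeff]
  simp only [smul_eq_mul, mul_comm]

lemma mem_hardyTwo {x : Lp ℂ 2 leb} : x ∈ hardyTwo ↔ ∀ n : ℤ, n < 0 → fourierCoeff x n = 0 :=
  Iff.rfl

lemma expLp_mem_hardyTwo (k : ℕ) : expLp leb k ∈ hardyTwo := by
  intro n hn
  rw [congrFun (fourierCoeff_congr_ae (coeFn_expLp leb k)) n, fourierCoeff_fourier_apply,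
    if_neg (by omega)]

lemma mem_hardyTwo_orthogonal {x : Lp ℂ 2 leb} (hx : ∀ n : ℤ, 0 ≤ n → fourierCoeff x n = 0) :
    x ∈ hardyTwoᗮ := by
  intro h hh
  rw [← (fourierBasis (T := (1 : ℝ))).tsum_inner_mul_inner h x]
  refine (tsum_congr fun n => ?_).trans tsum_zero
  rcases lt_or_ge n 0 with hn | hn
  · rw [← inner_conj_symm, ← HilbertBasis.repr_apply_apply, fourierBasis_repr,
      mem_hardyTwo.1 hh n hn, map_zero, zero_mul]
  · rw [← HilbertBasis.repr_apply_apply fourierBasis x, fourierBasis_repr, hx n hn, mul_zero]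

section

variable {μ : Measure Circle1} [IsFiniteMeasure μ] (hlog : LogIntegrable (acDensity μ))

include hlog

lemma aestronglyMeasurable_conj_outerFn :
    AEStronglyMeasurable (fun t => conj (outerFn (acDensity μ) t)) leb := by
  obtain ⟨F, h, -⟩ := exists_outerFn_ae_eq hlog (integrable_acDensity μ)
  refine ((Lp.aestronglyMeasurable F).star).congr ?_
  filter_upwards [h] with t ht
  rw [ht]
  rfl

lemma norm_outerFn_sq : ∀ᵐ t ∂leb, ‖outerFn (acDensity μ) t‖ ^ 2 = acDensity μ t := by
  obtain ⟨F, h, h1, -⟩ := exists_outerFn_ae_eq hlog (integrable_acDensity μ)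
  filter_upwards [h, h1] with t h2 h3
  rw [h2, h3]

lemma withDensity_conj_outerFn_le :
    leb.withDensity (fun t => ‖conj (outerFn (acDensity μ) t)‖ₑ ^ 2) ≤ μ := by
  refine le_of_eq_of_le (withDensity_congr_ae ?_) (Measure.withDensity_rnDeriv_le μ leb)
  filter_upwards [norm_outerFn_sq hlog, Measure.rnDeriv_lt_top μ leb] with t h1 h2
  rw [← ofReal_norm, RCLike.norm_conj, ← ENNReal.ofReal_pow (norm_nonneg _), h1, acDensity,
    ENNReal.ofReal_toReal h2.ne]

lemma memLp_mul_conj_outerFn {f : Circle1 → ℂ} (hf : MemLp f 2 μ) :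
    MemLp (fun t => f t * conj (outerFn (acDensity μ) t)) 2 leb :=
  memLp_mul (aestronglyMeasurable_conj_outerFn hlog) (withDensity_conj_outerFn_le hlog)
    (leb_absolutelyContinuous hlog.1) hf

omit hlog in
/-- Multiplication by the conjugate outer function, from `L²(μ)` to `L²(λ)`. -/
noncomputable def toLeb (hlog : LogIntegrable (acDensity μ)) : Lp ℂ 2 μ →L[ℂ] Lp ℂ 2 leb :=
  mulCLM (fun t => conj (outerFn (acDensity μ) t)) (aestronglyMeasurable_conj_outerFn hlog)
    (withDensity_conj_outerFn_le hlog) (leb_absolutelyContinuous hlog.1)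

lemma coeFn_toLeb (x : Lp ℂ 2 μ) :
    toLeb hlog x =ᵐ[leb] fun t => x t * conj (outerFn (acDensity μ) t) :=
  coeFn_mulCLM _ _ _ x

lemma toLeb_toLp {f : Circle1 → ℂ} (hf : MemLp f 2 μ) :
    toLeb hlog (hf.toLp f) = (memLp_mul_conj_outerFn hlog hf).toLp _ :=
  mulCLM_toLp _ _ _ hf

lemma toLeb_shift (k : ℤ) (x : Lp ℂ 2 μ) :
    toLeb hlog (shift μ k x) = shift leb k (toLeb hlog x) := by
  refine Lp.ext ?_
  filter_upwards [coeFn_toLeb hlog (shift μ k x), coeFn_shift leb k (toLeb hlog x),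
    coeFn_toLeb hlog x, (leb_absolutelyContinuous hlog.1).ae_le (coeFn_shift μ k x)]
    with t h1 h2 h3 h4
  rw [h1, h2, h3, h4]
  ring

lemma fourierCoeff_toLeb_expLp (j n : ℤ) : fourierCoeff (toLeb hlog (expLp μ j)) n
    = conj (fourierCoeff (outerFn (acDensity μ)) (j - n)) := by
  rw [fourierCoeff, fourierCoeff, ← integral_conj]
  refine integral_congr_ae ?_
  filter_upwards [coeFn_toLeb hlog (expLp μ j),
    (leb_absolutelyContinuous hlog.1).ae_le (coeFn_expLp μ j)] with t h1 h2
  rw [h1, h2, smul_eq_mul, smul_eq_mul, map_mul, ← fourier_neg, ← mul_assoc, ← fourier_add]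
  congr 3
  ring

lemma fourierCoeff_outerFn_neg {n : ℤ} (hn : n < 0) :
    fourierCoeff (outerFn (acDensity μ)) n = 0 := by
  obtain ⟨F, h, -, h1, -⟩ := exists_outerFn_ae_eq hlog (integrable_acDensity μ)
  rw [congrFun (fourierCoeff_congr_ae h) n, h1 n hn]

lemma fourierCoeff_outerFn_zero : fourierCoeff (outerFn (acDensity μ)) 0
    = (Real.exp (1 / 2 * ∫ t, Real.log (acDensity μ t) ∂leb) : ℂ) := by
  obtain ⟨F, h, -, -, h1⟩ := exists_outerFn_ae_eq hlog (integrable_acDensity μ)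
  rw [congrFun (fourierCoeff_congr_ae h) 0, h1]

lemma fourierCoeff_toLeb_past {x : Lp ℂ 2 μ} (hx : x ∈ past μ) {n : ℤ} (hn : 0 ≤ n) :
    fourierCoeff (toLeb hlog x) n = 0 := by
  set l := (innerSL ℂ (expLp leb n)).comp (toLeb hlog) with hl
  have hle : past μ ≤ LinearMap.ker (l : Lp ℂ 2 μ →ₗ[ℂ] ℂ) := past_le μ l.isClosed_ker fun j hj => by
    rw [LinearMap.mem_ker]
    change inner ℂ (expLp leb n) (toLeb hlog (expLp μ j)) = 0
    rw [← fourierCoeff_eq_inner, fourierCoeff_toLeb_expLp, fourierCoeff_outerFn_neg hlog (by omega),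
      map_zero]
  rw [fourierCoeff_eq_inner]
  exact LinearMap.mem_ker.1 (hle hx)

/-- The mean value of `w φ̄` is that of `φ̄`, since the past does not contribute. -/
lemma inner_toLeb_innovation : inner ℂ (expLp leb 0) (toLeb hlog (innovation μ))
    = (Real.exp (1 / 2 * ∫ t, Real.log (acDensity μ t) ∂leb) : ℂ) := by
  rw [innovation, map_sub, inner_sub_right, ← fourierCoeff_eq_inner, ← fourierCoeff_eq_inner,
    fourierCoeff_toLeb_past hlog (Submodule.starProjection_apply_mem _ _) le_rfl, sub_zero,
    fourierCoeff_toLeb_expLp, sub_self, fourierCoeff_outerFn_zero hlog, Complex.conj_ofReal]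

omit hlog in
lemma norm_expLp_leb (n : ℤ) : ‖expLp leb n‖ = 1 := by
  have h : (‖expLp leb n‖ : ℂ) ^ 2 = 1 := by
    have h1 := inner_self_eq_norm_sq_to_K (𝕜 := ℂ) (expLp leb n)
    rw [← fourierCoeff_eq_inner, congrFun (fourierCoeff_congr_ae (coeFn_expLp leb n)) n,
      fourierCoeff_fourier_apply, if_pos rfl] at h1
    exact h1.symm
  have h2 : ‖expLp leb n‖ ^ 2 = 1 := by exact_mod_cast h
  exact (pow_eq_one_iff_of_nonneg (norm_nonneg _) two_ne_zero).1 h2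

/-- Multiplication by the conjugate outer function turns the innovation into a constant. This is
the equality case of the Cauchy–Schwarz inequality, by the two bounds of Szegő's theorem. -/
lemma toLeb_innovation : toLeb hlog (innovation μ)
    = (Real.exp (1 / 2 * ∫ t, Real.log (acDensity μ t) ∂leb) : ℂ) • expLp leb 0 := by
  have h1 := inner_toLeb_innovation hlog
  set R := Real.exp (1 / 2 * ∫ t, Real.log (acDensity μ t) ∂leb) with hR
  have hR0 : 0 < R := Real.exp_pos _
  have h2 : ‖toLeb hlog (innovation μ)‖ ≤ ‖innovation μ‖ := norm_mulCLM_le _ _ _ _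
  have hw : innovation μ ≠ 0 := by
    intro h
    rw [h, map_zero, inner_zero_right] at h1
    exact hR0.ne (by exact_mod_cast h1)
  have h3 : ‖toLeb hlog (innovation μ)‖ ≤ R :=
    h2.trans (logIntegrable_of_innovation_ne_zero hw).2
  rw [← sub_eq_zero, ← norm_eq_zero, ← pow_eq_zero_iff two_ne_zero]
  refine le_antisymm ?_ (by positivity)
  rw [@norm_sub_sq ℂ, inner_smul_right, ← inner_conj_symm, h1, Complex.conj_ofReal, norm_smul,
    norm_expLp_leb, ← Complex.ofReal_mul, Complex.norm_real, Real.norm_of_nonneg hR0.le]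
  have h4 : ‖toLeb hlog (innovation μ)‖ ^ 2 ≤ R ^ 2 := by gcongr
  rw [RCLike.re_to_complex, Complex.ofReal_re]
  nlinarith

lemma toLeb_future_mem {x : Lp ℂ 2 μ} (hx : x ∈ future μ) : toLeb hlog x ∈ hardyTwo := by
  have hle : future μ ≤ hardyTwo.comap (toLeb hlog : Lp ℂ 2 μ →ₗ[ℂ] Lp ℂ 2 leb) := by
    refine future_le μ (isClosed_hardyTwo.preimage (toLeb hlog).continuous) fun k => ?_
    change toLeb hlog (shift μ k (innovation μ)) ∈ hardyTwo
    rw [toLeb_shift, toLeb_innovation, map_smul, shift_expLp, zero_add]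
    exact hardyTwo.smul_mem _ (expLp_mem_hardyTwo k)
  exact hle hx

/-- Multiplication by the conjugate outer function preserves inner products with `e_k w`, as `w`
vanishes almost everywhere for the singular part. -/
lemma inner_toLeb_shift_innovation (k : ℤ) (y : Lp ℂ 2 μ) :
    inner ℂ (toLeb hlog (shift μ k (innovation μ))) (toLeb hlog y)
      = inner ℂ (shift μ k (innovation μ)) y := by
  have hi : Integrable (fun t => y t * conj (shift μ k (innovation μ) t)) μ := by
    have := L2.integrable_inner (𝕜 := ℂ) (shift μ k (innovation μ)) y
    exact this
  have h0 : ∀ᵐ t ∂(μ.singularPart leb), y t * conj (shift μ k (innovation μ) t) = 0 := by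
    filter_upwards [innovation_ae_singularPart μ,
      ae_mono (μ.singularPart_le leb) (coeFn_shift μ k (innovation μ))] with t h1 h2
    rw [h2, h1, zero_mul, map_zero, mul_zero]
  rw [inner_Lp_eq_integral, inner_Lp_eq_integral, integral_eq_integral_acDensity μ hi h0]
  refine integral_congr_ae ?_
  filter_upwards [coeFn_toLeb hlog y, coeFn_toLeb hlog (shift μ k (innovation μ)),
    norm_outerFn_sq hlog] with t h1 h2 h3
  rw [h1, h2, ← h3, map_mul, Complex.conj_conj, Complex.ofReal_pow, ← Complex.mul_conj']
  ring

lemma inner_toLeb {x : Lp ℂ 2 μ} (hx : x ∈ future μ) (y : Lp ℂ 2 μ) :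
    inner ℂ (toLeb hlog x) (toLeb hlog y) = inner ℂ x y := by
  set l := ((innerSL ℂ (toLeb hlog y)).comp (toLeb hlog)) - innerSL ℂ y with hl
  have hle : future μ ≤ LinearMap.ker (l : Lp ℂ 2 μ →ₗ[ℂ] ℂ) :=
    future_le μ l.isClosed_ker fun k => by
      rw [LinearMap.mem_ker]
      change inner ℂ (toLeb hlog y) (toLeb hlog (shift μ k (innovation μ)))
        - inner ℂ y (shift μ k (innovation μ)) = 0
      rw [← inner_conj_symm, inner_toLeb_shift_innovation, inner_conj_symm, sub_self]
  have h : inner ℂ (toLeb hlog y) (toLeb hlog x) - inner ℂ y x = 0 := LinearMap.mem_ker.1 (hle hx)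
  rw [← inner_conj_symm, sub_eq_zero.1 h, inner_conj_symm]

/-- Multiplication by the conjugate outer function intertwines the projection to the complement of
the past with the projection to the Hardy space. -/
lemma starProjection_toLeb (x : Lp ℂ 2 μ) :
    hardyTwo.starProjection (toLeb hlog x)
      = toLeb hlog (x - (past μ).starProjection x) := by
  refine Submodule.eq_starProjection_of_mem_orthogonal
    (toLeb_future_mem hlog (past_orthogonal_le_future μ
      (Submodule.sub_starProjection_mem_orthogonal x))) ?_
  rw [← map_sub, sub_sub_cancel]
  exact mem_hardyTwo_orthogonal fun n hn =>
    fourierCoeff_toLeb_past hlog (Submodule.starProjection_apply_mem _ _) hn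

end

section

variable {μ : Measure Circle1} [IsFiniteMeasure μ]

lemma memLp_mul_conj_outerFn_acDensity {f : Circle1 → ℂ} (hf : MemLp f 2 μ) :
    MemLp (fun t => f t * conj (outerFn (acDensity μ) t)) 2 leb := by
  by_cases hlog : LogIntegrable (acDensity μ)
  · exact memLp_mul_conj_outerFn hlog hf
  · simp [outerFn_of_not_logIntegrable hlog]

/-- The inner products of the components orthogonal to the past are inner products in the Hardy
space. -/
theorem inner_sub_starProjection_past {f g : Circle1 → ℂ} (hf : MemLp f 2 μ) (hg : MemLp g 2 μ) :
    inner ℂ (hg.toLp g) (hf.toLp f - (past μ).starProjection (hf.toLp f))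
      = ∫ t, projHardy (fun s => f s * conj (outerFn (acDensity μ) s)) t
          * conj (projHardy (fun s => g s * conj (outerFn (acDensity μ) s)) t) ∂leb := by
  have hf' := memLp_mul_conj_outerFn_acDensity hf
  have hg' := memLp_mul_conj_outerFn_acDensity hg
  rw [projHardy, projHardy, dif_pos hf', dif_pos hg', ← inner_Lp_eq_integral]
  have hQ : ∀ x : Lp ℂ 2 μ, x - (past μ).starProjection x ∈ (past μ)ᗮ := fun x =>
    Submodule.sub_starProjection_mem_orthogonal x
  by_cases hlog : LogIntegrable (acDensity μ)
  · rw [← toLeb_toLp hlog hf, ← toLeb_toLp hlog hg, starProjection_toLeb, starProjection_toLeb,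
      inner_toLeb hlog (past_orthogonal_le_future μ (hQ _)), inner_sub_left,
      hQ _ _ (Submodule.starProjection_apply_mem _ _), sub_zero]
  · -- without a logarithmic integral the past is everything and the outer function is zero
    have hw : innovation μ = 0 := by
      by_contra h
      exact hlog (logIntegrable_of_innovation_ne_zero h).1
    have hbot : future μ ≤ ⊥ := future_le μ (by simp) fun k => by simp [hw]
    have h1 : hf.toLp f - (past μ).starProjection (hf.toLp f) = 0 :=
      (Submodule.mem_bot ℂ).1 (hbot (past_orthogonal_le_future μ (hQ _)))
    have h2 : hf'.toLp (fun s => f s * conj (outerFn (acDensity μ) s)) = 0 := by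
      refine Lp.ext ?_
      filter_upwards [hf'.coeFn_toLp, Lp.coeFn_zero ℂ 2 leb] with t h3 h4
      rw [h3, h4, outerFn_of_not_logIntegrable hlog, map_zero, mul_zero, Pi.zero_apply]
    rw [h1, h2, map_zero, inner_zero_right, inner_zero_right]

end

/-! ### Gram determinants -/

/-- The Schur complement of a Gram matrix: bordering it by vectors `x`, `y` multiplies the
determinant by that of the inner products of `y` with the components of `x` orthogonal to the
span. -/
lemma det_fromBlocks_gram {E ι κ : Type*} [NormedAddCommGroup E] [InnerProductSpace ℂ E]
    [Fintype ι] [DecidableEq ι] [Fintype κ] [DecidableEq κ] (e : ι → E)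
    (U : Submodule ℂ E) [U.HasOrthogonalProjection] (hU : U = Submodule.span ℂ (Set.range e)) (x y : κ → E)
    (hA : (Matrix.of fun j k : ι => (inner ℂ (e k) (e j) : ℂ)).det ≠ 0) :
    (Matrix.fromBlocks (Matrix.of fun j k : ι => (inner ℂ (e k) (e j) : ℂ))
      (Matrix.of fun j k => inner ℂ (y k) (e j)) (Matrix.of fun j k => inner ℂ (e k) (x j))
      (Matrix.of fun j k => inner ℂ (y k) (x j))).det
    = (Matrix.of fun j k : ι => (inner ℂ (e k) (e j) : ℂ)).det
      * (Matrix.of fun j k : κ => (inner ℂ (y k)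
        (x j - U.starProjection (x j)) : ℂ)).det := by
  set A := Matrix.of fun j k : ι => (inner ℂ (e k) (e j) : ℂ) with hAdef
  have := A.invertibleOfIsUnitDet (isUnit_iff_ne_zero.2 hA)
  have hM : ∀ j, ∃ c : ι → ℂ, ∑ i, c i • e i = U.starProjection (x j) := fun j =>
    (Submodule.mem_span_range_iff_exists_fun ℂ).1 (hU ▸ U.starProjection_apply_mem (x j))
  choose M hM using hM
  have hC : (Matrix.of fun j k => inner ℂ (e k) (x j)) = Matrix.of M * A := by
    ext j k
    have h1 : inner ℂ (e k) (x j - U.starProjection (x j)) = 0 :=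
      Submodule.sub_starProjection_mem_orthogonal (x j) _ (hU ▸ Submodule.subset_span ⟨k, rfl⟩)
    rw [inner_sub_right, sub_eq_zero] at h1
    simp only [Matrix.of_apply, Matrix.mul_apply, h1, ← hM, inner_sum, inner_smul_right, hAdef]
  rw [Matrix.det_fromBlocks₁₁, hC, Matrix.mul_assoc (Matrix.of M), mul_invOf_self, Matrix.mul_one]
  congr 2
  ext j k
  simp only [Matrix.sub_apply, Matrix.of_apply, Matrix.mul_apply, inner_sub_right, ← hM, inner_sum,
    inner_smul_right]

lemma inner_toLp_toLp (μ : Measure Circle1) {p q : Circle1 → ℂ} (hp : MemLp p 2 μ) (hq : MemLp q 2 μ) :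
    inner ℂ (hq.toLp q) (hp.toLp p) = ∫ t, p t * conj (q t) ∂μ := by
  rw [inner_Lp_eq_integral]
  refine integral_congr_ae ?_
  filter_upwards [hp.coeFn_toLp, hq.coeFn_toLp] with t h1 h2
  rw [h1, h2]

section

variable (μ : Measure Circle1) [IsFiniteMeasure μ]

lemma inner_expLp_expLp (j k : ℤ) :
    inner ℂ (expLp μ k) (expLp μ j) = ∫ t, (fourier (j - k) t : ℂ) ∂μ := by
  rw [inner_expLp]
  refine integral_congr_ae ?_
  filter_upwards [coeFn_expLp μ j] with t ht
  rw [ht, ← fourier_add, sub_eq_add_neg]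

lemma toeplitzDet_eq (n : ℕ) : toeplitzDet μ n = (Matrix.of fun j k : Fin n =>
    (inner ℂ (expLp μ (-((k : ℤ) + 1))) (expLp μ (-((j : ℤ) + 1))) : ℂ)).det := by
  rw [toeplitzDet, ← Matrix.det_transpose]
  congr 1
  ext j k
  rw [Matrix.transpose_apply, Matrix.of_apply, Matrix.of_apply, inner_expLp_expLp, measureCoeff]
  congr 1 with t
  rw [← fourier_neg]
  congr 2
  ring

lemma toeplitzDet_ne_zero (hμ : μ.support.Infinite) (n : ℕ) : toeplitzDet μ n ≠ 0 := by
  rw [toeplitzDet_eq]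
  intro hdet
  obtain ⟨v, hv0, hv⟩ := Matrix.exists_vecMul_eq_zero_iff.2 hdet
  set e : Fin n → Lp ℂ 2 μ := fun j => expLp μ (-((j : ℤ) + 1)) with he
  -- the combination of exponentials in the kernel of the Gram matrix vanishes in `L²(μ)`
  have hz : ∑ j, v j • e j = 0 := by
    rw [← inner_self_eq_zero (𝕜 := ℂ), sum_inner]
    refine Finset.sum_eq_zero fun k _ => ?_
    have h1 := congrFun hv k
    simp only [Matrix.vecMul, dotProduct, Matrix.of_apply, Pi.zero_apply] at h1
    rw [inner_smul_left, inner_sum]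
    simp only [inner_smul_right]
    rw [h1, mul_zero]
  set p : Circle1 → ℂ := fun t => ∑ j : Fin n, v j * fourier (-((j : ℤ) + 1)) t with hp
  have hae : ∀ᵐ t ∂μ, p t = 0 := by
    have h1 : (∑ j, v j • e j : Lp ℂ 2 μ) =ᵐ[μ] p := by
      have h2 : ∀ᵐ t ∂μ, ∀ j, (v j • e j : Lp ℂ 2 μ) t = v j * fourier (-((j : ℤ) + 1)) t := by
        rw [ae_all_iff]
        intro j
        filter_upwards [Lp.coeFn_smul (v j) (e j), coeFn_expLp μ (-((j : ℤ) + 1))] with t h3 h4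
        rw [h3, Pi.smul_apply, h4, smul_eq_mul]
      filter_upwards [h2, Lp.coeFn_finsetSum Finset.univ (fun j => v j • e j)] with t h5 h6
      rw [h6, Finset.sum_apply]
      exact Finset.sum_congr rfl fun j _ => h5 j
    rw [hz] at h1
    filter_upwards [h1, Lp.coeFn_zero ℂ 2 μ] with t h3 h4
    rw [← h3, h4, Pi.zero_apply]
  have hclosed : IsClosed {t | p t = 0} := isClosed_eq (by fun_prop) continuous_const
  have hsupp : μ.support ⊆ {t | p t = 0} := Measure.support_subset_of_isClosed hclosed hae
  set P : Polynomial ℂ := ∑ j : Fin n, Polynomial.C (v j) * Polynomial.X ^ (j : ℕ) with hP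
  have hpP : ∀ t, p t = fourier (-1) t * P.eval (fourier (-1) t : ℂ) := by
    intro t
    rw [hP, Polynomial.eval_finsetSum, Finset.mul_sum]
    refine Finset.sum_congr rfl fun j _ => ?_
    rw [Polynomial.eval_mul, Polynomial.eval_C, Polynomial.eval_pow, Polynomial.eval_X, fourier_pow,
      mul_left_comm, ← fourier_add]
    congr 3
    ring
  have hinj : Function.Injective fun t : Circle1 => (fourier (-1) t : ℂ) := by
    intro s t hst
    simp only [fourier_neg] at hst
    have h1 := RingHom.injective _ hst
    rw [fourier_one, fourier_one] at h1
    exact AddCircle.injective_toCircle one_ne_zero (Circle.ext h1)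
  have hP0 : P = 0 := by
    refine Polynomial.eq_zero_of_infinite_isRoot P
      ((hμ.image hinj.injOn).mono ?_)
    rintro _ ⟨t, ht, rfl⟩
    have h1 : p t = 0 := hsupp ht
    rw [hpP, mul_eq_zero] at h1
    refine h1.resolve_left fun h2 => ?_
    have := norm_fourier_apply (-1) t
    rw [h2, norm_zero] at this
    exact zero_ne_one this
  refine hv0 (funext fun j => ?_)
  have h1 := congrArg (fun Q => Polynomial.coeff Q (j : ℕ)) hP0
  simp only [hP, Polynomial.finsetSum_coeff, Polynomial.coeff_C_mul_X_pow,
    Polynomial.coeff_zero] at h1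
  rw [Finset.sum_eq_single j (fun k _ hk => if_neg fun h => hk (Fin.ext h.symm)) (by simp),
    if_pos rfl] at h1
  exact h1

lemma borderedDet_eq (hμ : μ.support.Infinite) (n : ℕ) {r : ℕ} {f g : Fin (r + 1) → Circle1 → ℂ}
    (hf : ∀ j, MemLp (f j) 2 μ) (hg : ∀ j, MemLp (g j) 2 μ) :
    borderedDet μ n f g = toeplitzDet μ n * (Matrix.of fun j k : Fin (r + 1) =>
      (inner ℂ ((hg k).toLp (g k))
        ((hf j).toLp (f j) - (pastFin μ n).starProjection ((hf j).toLp (f j))) : ℂ)).det := by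
  have h0 := toeplitzDet_ne_zero μ hμ n
  rw [toeplitzDet_eq] at h0 ⊢
  have h := det_fromBlocks_gram (fun i : Fin n => expLp μ (-((i : ℤ) + 1)))
    (pastFin μ n) rfl (fun j => (hf j).toLp (f j)) (fun j => (hg j).toLp (g j)) h0
  refine Eq.trans ?_ h
  rw [borderedDet]
  congr 1
  ext (j | j) (k | k)
  · exact (inner_toLp_toLp μ (memLp_fourier μ _) (memLp_fourier μ _)).symm
  · exact (inner_toLp_toLp μ (memLp_fourier μ _) (hg k)).symm
  · exact (inner_toLp_toLp μ (hf j) (memLp_fourier μ _)).symm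
  · exact (inner_toLp_toLp μ (hf j) (hg k)).symm

end

end SzegoLimit

theorem theorem3p1 (μ : MeasureTheory.Measure SzegoLimit.Circle1)
    [MeasureTheory.IsFiniteMeasure μ] (hμ : μ.support.Infinite)
    (r : ℕ) (f g : Fin (r + 1) → SzegoLimit.Circle1 → ℂ)
    (hf : ∀ j, MemLp (f j) 2 μ) (hg : ∀ j, MemLp (g j) 2 μ)
    (φ : SzegoLimit.Circle1 → ℂ) (hφ : φ = SzegoLimit.outerFn (SzegoLimit.acDensity μ)) :
    -- the projections and the quotients in the limit relation are well defined
    (∀ j, MemLp (fun t => f j t * conj (φ t)) 2 SzegoLimit.leb) ∧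
    (∀ j, MemLp (fun t => g j t * conj (φ t)) 2 SzegoLimit.leb) ∧
    (∀ n : ℕ, SzegoLimit.toeplitzDet μ n ≠ 0) ∧
    -- the limit relation
    Tendsto (fun n : ℕ => (SzegoLimit.toeplitzDet μ n)⁻¹ * SzegoLimit.borderedDet μ n f g) atTop
      (𝓝 (Matrix.of fun j k : Fin (r + 1) =>
        ∫ t, SzegoLimit.projHardy (fun s => f j s * conj (φ s)) t *
          conj (SzegoLimit.projHardy (fun s => g k s * conj (φ s)) t) ∂SzegoLimit.leb).det) := by
  subst hφ
  have hD := SzegoLimit.toeplitzDet_ne_zero μ hμ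
  refine ⟨fun j => SzegoLimit.memLp_mul_conj_outerFn_acDensity (hf j),
    fun j => SzegoLimit.memLp_mul_conj_outerFn_acDensity (hg j), hD, ?_⟩
  have heq : ∀ n : ℕ, (SzegoLimit.toeplitzDet μ n)⁻¹ * SzegoLimit.borderedDet μ n f g
      = (Matrix.of fun j k : Fin (r + 1) => (inner ℂ ((hg k).toLp (g k)) ((hf j).toLp (f j)
        - (SzegoLimit.pastFin μ n).starProjection ((hf j).toLp (f j))) : ℂ)).det := fun n => by
    rw [SzegoLimit.borderedDet_eq μ hμ n hf hg, inv_mul_cancel_left₀ (hD n)]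
  simp_rw [heq, ← SzegoLimit.inner_sub_starProjection_past (hf _) (hg _)]
  refine ((continuous_id.matrix_det).tendsto _).comp ?_
  refine tendsto_pi_nhds.2 fun j => tendsto_pi_nhds.2 fun k => ?_
  have hlim : Tendsto (fun n => (SzegoLimit.pastFin μ n).starProjection ((hf j).toLp (f j))) atTop
      (𝓝 ((SzegoLimit.past μ).starProjection ((hf j).toLp (f j)))) :=
    Submodule.starProjection_tendsto_closure_iSup _ (SzegoLimit.pastFin_mono μ) _
  exact tendsto_const_nhds.inner (tendsto_const_nhds.sub hlim)
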